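/- **Setting.** Let $\mathcal C$ be a compact closed category (symmetric monoidal with unit $I$, every object $A$ having a dual $A^*$ with cup $\eta_A : I\to A^*\otimes A$ and cap $\epsilon_A : A\otimes A^*\to I$ satisfying the yanking equations) with finite products; these are then biproducts and $\mathcal C$ is enriched in commutative monoids. Composition $f ; g$ is in diagrammatic order and coherence isomorphisms are suppressed. States, effects and scalars are morphisms $I\to A$, $A\to I$ and $I\to I$. $\mathcal C$ is an *additive precausal category* if it is equipped with discarding effects $d_A : A\to I$ such that 1. $d_{A\otimes B}=d_A\otimes d_B$, $d_I=\mathrm{id}_I$ and $d_{A\oplus B}=\langle d_A,d_B\rangle$; 2. the scalar $u_A ; d_A$ is invertible for every non-zero object $A$, where the uniform state $u_A : I\to A$ is the transpose of $d_{A^*}$; 3. every $A$ has finitely many states $\rho_i$ with $\rho_i ; d_A=\mathrm{id}_I$ such that, for all $B$ and $f,g : A\to B$, if $\rho_i ; f=\rho_i ; g$ for all $i$ then $f=g$; 4. addition of scalars is cancellative, for all scalars $x,y$ there is $z$ with $x+z=y$ or $x=y+z$, and every non-zero scalar is invertible; 5. for every effect $\pi : A\to I$ there are an effect $\pi'$ and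 a scalar $\lambda$ with $\pi+\pi'=\lambda\cdot d_A$. The *dual* of a set $c$ of states of $A$ is $c^*=\{\pi : A\to I \mid \rho ; \pi=\mathrm{id}_I \text{ for all }\rho\in c\}$, also regarded through transposition as a set of states of $A^*$; duals of sets of effects are defined likewise, and a set of states of $A^*\otimes B^*$ is also regarded as a set of effects on $A\otimes B$. The set $c$ is *closed* if $c=c^{**}$, and *flat* if $A$ is a zero object or there are invertible scalars $\lambda,\mu$ with $\lambda\cdot u_A\in c$ and $\mu\cdot d_A\in c^*$. An object $\mathbf A=(A,c_{\mathbf A})$ of $\mathrm{Caus}[\mathcal C]$ is an object $A$ of $\mathcal C$ with a closed and flat set $c_{\mathbf A}$ of states of $A$. For sets $c, c'$ of states of $A, B$ put $c\otimes c'=\{\rho\otimes\sigma\mid\rho\in c,\ \sigma\in c'\}^{**}$ and $c\mathbin{\mathrm{par}} c'=(c^*\otimes c'^*)^*$, a set of states of $A\otimes B$, and define the following subsets of $c\mathbin{\mathrm{par}} c'$. - $c<c'$: those $h$ for which there is $m\in c$ with $h ; (\mathrm{id}_A\otimes\pi)=m$ for all $\pi\in c'^*$. - $c\triangleleft c'$: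 those $h$ for which there are an object $Z$ of $\mathcal C$, with first-order set $c_Z=\{d_Z\}^*$, and $m\in c\mathbin{\mathrm{par}} c_Z$, $n\in c_Z^*\mathbin{\mathrm{par}} c'$ such that $h=(m\otimes n) ; (\mathrm{id}_A\otimes\epsilon_Z\otimes\mathrm{id}_B)$. - $c\oslash c'$: those $h$ for which there are a finite (possibly empty) index set $\mathcal I$, morphisms $f_i\in\mathrm{Sub}(\mathcal C)(I,A)$ and states $g_i\in c'$ ($i\in\mathcal I$), and $f\in c$, such that $[h]=\sum_i f_i\otimes[g_i]$ and $[f]=\sum_i f_i$ in $\mathrm{Sub}(\mathcal C)$. Here $\mathrm{Sub}(\mathcal C)$ is the subtractive closure of $\mathcal C$: its morphisms $X\to Y$ are formal differences $f-g$ of morphisms $f,g\in\mathcal C(X,Y)$, with $f-g=f'-g'$ iff $f+g'=f'+g$; $\otimes$ is extended biadditively, and $[f]=f-0$. **Theorem.** Let $\mathcal C$ be an additive precausal category. For all objects $\mathbf A,\mathbf B$ of $\mathrm{Caus}[\mathcal C]$, $$c_{\mathbf A}<c_{\mathbf B}\;=\;\left(c_{\mathbf A}^*<c_{\mathbf B}^*\right)^*\;=\;\left(c_{\mathbf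 A}\triangleleft c_{\mathbf B}\right)^{**}\;=\;c_{\mathbf A}\oslash c_{\mathbf B}.$$ -/

import Mathlib

open CategoryTheory MonoidalCategory Limits

universe v u

set_option linter.unusedSectionVars false

noncomputable section

namespace HigherOrder

variable {C : Type u} [Category.{v} C] [MonoidalCategory C] [SymmetricCategory C]
  [LeftRigidCategory C]

/-! ### Compact closed categories with finite products have biproducts

A compact closed category is a symmetric monoidal category in which every object `A` has a
(left) dual `ᘁA`, with cup `η_ (ᘁA) A : 𝟙_ C ⟶ ᘁA ⊗ A` and cap `ε_ (ᘁA) A : A ⊗ ᘁA ⟶ 𝟙_ C`. -/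

section Biproducts

/-- The dual object of `A`. -/
abbrev dualObj (A : C) : C := HasLeftDual.leftDual A

/-- The cup `𝟙_ C ⟶ A* ⊗ A`. -/
abbrev cup (A : C) : 𝟙_ C ⟶ dualObj A ⊗ A := ExactPairing.coevaluation (dualObj A) A

/-- The cap `A ⊗ A* ⟶ 𝟙_ C`. -/
abbrev cap (A : C) : A ⊗ dualObj A ⟶ 𝟙_ C := ExactPairing.evaluation (dualObj A) A

/-- By symmetry, `A` is also a left dual of `A*`. -/
abbrev swapPairing (A : C) : ExactPairing A (dualObj A) :=
  BraidedCategory.exactPairing_swap (dualObj A) A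

instance preservesLimits_tensorRight (T : C) {J : Type} [SmallCategory J] :
    PreservesLimitsOfShape J (tensorRight T) :=
  ((tensorRightAdjunction (dualObj T) T).rightAdjoint_preservesLimits).preservesLimitsOfShape

instance preservesLimits_tensorLeft_star (T : C) {J : Type} [SmallCategory J] :
    PreservesLimitsOfShape J (tensorLeft (dualObj T)) :=
  ((tensorLeftAdjunction (dualObj T) T).rightAdjoint_preservesLimits).preservesLimitsOfShape

variable [HasFiniteProducts C]

/-- Two morphisms out of `(𝟙 ⨯ 𝟙)* ⊗ X` are the same as two morphisms out of `X`. -/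
def legs (X T : C) (φ : dualObj (𝟙_ C ⨯ 𝟙_ C) ⊗ X ⟶ T) : (X ⟶ T) × (X ⟶ T) :=
  letI := swapPairing (𝟙_ C ⨯ 𝟙_ C)
  let ψ := tensorLeftHomEquiv X (𝟙_ C ⨯ 𝟙_ C) (dualObj (𝟙_ C ⨯ 𝟙_ C)) T φ
  (ψ ≫ (prod.fst : 𝟙_ C ⨯ 𝟙_ C ⟶ 𝟙_ C) ▷ T ≫ (λ_ T).hom,
    ψ ≫ (prod.snd : 𝟙_ C ⨯ 𝟙_ C ⟶ 𝟙_ C) ▷ T ≫ (λ_ T).hom)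

theorem legs_bijective (X T : C) : Function.Bijective (legs X T) := by
  let l := mapIsLimitOfPreservesOfIsLimit (tensorRight T) _ _ (prodIsProd (𝟙_ C) (𝟙_ C))
  let := swapPairing (𝟙_ C ⨯ 𝟙_ C)
  constructor
  · intro φ φ' h
    apply (tensorLeftHomEquiv X (𝟙_ C ⨯ 𝟙_ C) (dualObj (𝟙_ C ⨯ 𝟙_ C)) T).injective
    have h1 := congrArg Prod.fst h
    have h2 := congrArg Prod.snd h
    simp only [legs, ← Category.assoc, cancel_mono] at h1 h2
    exact BinaryFan.IsLimit.hom_ext l h1 h2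
  · rintro ⟨f, g⟩
    obtain ⟨m, h1, h2⟩ := BinaryFan.IsLimit.lift' l (f ≫ (λ_ T).inv) (g ≫ (λ_ T).inv)
    refine ⟨(tensorLeftHomEquiv X (𝟙_ C ⨯ 𝟙_ C) (dualObj (𝟙_ C ⨯ 𝟙_ C)) T).symm m, ?_⟩
    simp only [legs, Equiv.apply_symm_apply]
    ext
    · exact (reassoc_of% h1) _ |>.trans (by simp)
    · exact (reassoc_of% h2) _ |>.trans (by simp)

theorem legs_comp (X T T' : C) (φ : dualObj (𝟙_ C ⨯ 𝟙_ C) ⊗ X ⟶ T) (t : T ⟶ T') :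
    legs X T' (φ ≫ t) = ((legs X T φ).1 ≫ t, (legs X T φ).2 ≫ t) := by
  simp only [legs, tensorLeftHomEquiv_naturality, Category.assoc]
  simp [whisker_exchange_assoc]

theorem legs_whisker (X Y T : C) (x : X ⟶ Y) (φ : dualObj (𝟙_ C ⨯ 𝟙_ C) ⊗ Y ⟶ T) :
    legs X T (dualObj (𝟙_ C ⨯ 𝟙_ C) ◁ x ≫ φ) = (x ≫ (legs Y T φ).1, x ≫ (legs Y T φ).2) := by
  let := swapPairing (𝟙_ C ⨯ 𝟙_ C)
  have : tensorLeftHomEquiv X (𝟙_ C ⨯ 𝟙_ C) (dualObj (𝟙_ C ⨯ 𝟙_ C)) T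
      (dualObj (𝟙_ C ⨯ 𝟙_ C) ◁ x ≫ φ) = x ≫ tensorLeftHomEquiv Y (𝟙_ C ⨯ 𝟙_ C) _ T φ := by
    rw [← Equiv.eq_symm_apply, tensorLeftHomEquiv_symm_naturality, Equiv.symm_apply_apply]
  simp only [legs, this, Category.assoc]

theorem isZero_terminal : IsZero (⊤_ C) := by
  have t1 : IsTerminal (dualObj (⊤_ C) ⊗ ⊤_ C) :=
    IsTerminal.isTerminalObj (tensorLeft (dualObj (⊤_ C))) _ terminalIsTerminal
  have hz : IsZero (dualObj (⊤_ C) ⊗ ⊤_ C) := by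
    constructor
    · intro Y
      let := swapPairing (⊤_ C)
      have t2 : IsTerminal ((⊤_ C : C) ⊗ Y) :=
        IsTerminal.isTerminalObj (tensorRight Y) _ terminalIsTerminal
      let e := tensorLeftHomEquiv (⊤_ C) (⊤_ C) (dualObj (⊤_ C)) Y
      exact ⟨⟨⟨e.symm (t2.from _)⟩, fun f => e.injective (t2.hom_ext _ _)⟩⟩
    · intro Y
      exact ⟨⟨⟨t1.from Y⟩, fun f => t1.hom_ext _ _⟩⟩
  exact hz.of_iso (terminalIsTerminal.uniqueUpToIso t1)

instance : HasZeroObject C := ⟨⟨⊤_ C, isZero_terminal⟩⟩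

instance : HasZeroMorphisms C := HasZeroObject.zeroMorphismsOfZeroObject

/-- The product `A ⨯ B` with its projections and its injections. -/
def prodBicone (A B : C) : BinaryBicone A B where
  pt := A ⨯ B
  fst := prod.fst
  snd := prod.snd
  inl := prod.lift (𝟙 A) 0
  inr := prod.lift 0 (𝟙 B)
  inl_fst := prod.lift_fst _ _
  inl_snd := prod.lift_snd _ _
  inr_fst := prod.lift_fst _ _
  inr_snd := prod.lift_snd _ _

/-- The injections into a binary product form a coproduct cocone. -/
theorem exists_desc_of_isLimit {A B : C} (b : BinaryBicone A B) (hb : IsLimit b.toCone)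
    (T : C) (f : A ⟶ T) (g : B ⟶ T) :
    ∃ m : b.pt ⟶ T, b.inl ≫ m = f ∧ b.inr ≫ m = g ∧
      ∀ m' : b.pt ⟶ T, b.inl ≫ m' = f → b.inr ≫ m' = g →
        m' = m := by
  let D : C := dualObj (𝟙_ C ⨯ 𝟙_ C)
  -- the two injections of `X` into `D ⊗ X`
  let j₁ : ∀ X : C, X ⟶ D ⊗ X := fun X => (legs X (D ⊗ X) (𝟙 _)).1
  let j₂ : ∀ X : C, X ⟶ D ⊗ X := fun X => (legs X (D ⊗ X) (𝟙 _)).2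
  have hj : ∀ (X S : C) (φ : D ⊗ X ⟶ S), legs X S φ = (j₁ X ≫ φ, j₂ X ≫ φ) := by
    intro X S φ
    have := legs_comp X (D ⊗ X) S (𝟙 _) φ
    rwa [Category.id_comp] at this
  have nat : ∀ {X Y : C} (x : X ⟶ Y), j₁ X ≫ D ◁ x = x ≫ j₁ Y ∧ j₂ X ≫ D ◁ x = x ≫ j₂ Y := by
    intro X Y x
    have h := legs_whisker X Y (D ⊗ Y) x (𝟙 _)
    rw [Category.comp_id, hj] at h
    exact ⟨congrArg Prod.fst h, congrArg Prod.snd h⟩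
  have ext : ∀ {X S : C} (φ φ' : D ⊗ X ⟶ S), j₁ X ≫ φ = j₁ X ≫ φ' → j₂ X ≫ φ = j₂ X ≫ φ' →
      φ = φ' := by
    intro X S φ φ' h1 h2
    apply (legs_bijective X S).1
    rw [hj, hj, h1, h2]
  have desc : ∀ {X S : C} (a b : X ⟶ S), ∃ φ : D ⊗ X ⟶ S, j₁ X ≫ φ = a ∧ j₂ X ≫ φ = b := by
    intro X S a b
    obtain ⟨φ, h⟩ := (legs_bijective X S).2 (a, b)
    rw [hj] at h
    exact ⟨φ, congrArg Prod.fst h, congrArg Prod.snd h⟩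
  obtain ⟨J, q₁, q₂, ⟨lJ⟩⟩ : ∃ (J : C) (q₁ q₂ : J ⟶ b.pt),
      Nonempty (IsLimit (BinaryFan.mk q₁ q₂)) :=
    ⟨_, _, _, ⟨prodIsProd b.pt b.pt⟩⟩
  have pair : ∀ {S : C} (x y : S ⟶ b.pt), ∃ z : S ⟶ J, z ≫ q₁ = x ∧ z ≫ q₂ = y := by
    intro S x y
    obtain ⟨m, h1, h2⟩ := BinaryFan.IsLimit.lift' lJ x y
    exact ⟨m, h1, h2⟩
  let l := mapIsLimitOfPreservesOfIsLimit (tensorLeft D) _ _ lJ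
  have lext : ∀ {S : C} (x y : S ⟶ D ⊗ J), x ≫ D ◁ q₁ = y ≫ D ◁ q₁ → x ≫ D ◁ q₂ = y ≫ D ◁ q₂ →
      x = y := fun x y h1 h2 => BinaryFan.IsLimit.hom_ext l h1 h2
  obtain ⟨w, hw1, hw2⟩ : ∃ w : b.pt ⟶ D ⊗ J,
      w ≫ D ◁ q₁ = b.fst ≫ b.inl ≫ j₁ b.pt ∧ w ≫ D ◁ q₂ = b.snd ≫ b.inr ≫ j₂ b.pt := by
    obtain ⟨m, h1, h2⟩ :=
      BinaryFan.IsLimit.lift' l (b.fst ≫ b.inl ≫ j₁ b.pt) (b.snd ≫ b.inr ≫ j₂ b.pt)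
    exact ⟨m, h1, h2⟩
  obtain ⟨zA, hA1, hA2⟩ := pair b.inl (0 : A ⟶ b.pt)
  obtain ⟨zB, hB1, hB2⟩ := pair (0 : B ⟶ b.pt) b.inr
  have inl1 : b.inl ≫ w = zA ≫ j₁ J := by
    apply lext
    · simp [hw1, (nat q₁).1, reassoc_of% hA1]
    · simp [hw2, (nat q₂).1, reassoc_of% hA2]
  have inr1 : b.inr ≫ w = zB ≫ j₂ J := by
    apply lext
    · simp [hw1, (nat q₁).2, reassoc_of% hB1]
    · simp [hw2, (nat q₂).2, reassoc_of% hB2]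
  obtain ⟨r, hr1, hr2⟩ := desc (q₁ ≫ b.fst ≫ b.inl) (q₂ ≫ b.snd ≫ b.inr)
  have n1 := fun {Y : C} (x : J ⟶ Y) => (nat x).1
  have n2 := fun {Y : C} (x : J ⟶ Y) => (nat x).2
  have hwr : w ≫ r = 𝟙 _ := by
    apply BinaryFan.IsLimit.hom_ext hb
    · obtain ⟨k, hk1, hk2⟩ := desc b.fst (0 : b.pt ⟶ A)
      have : r ≫ b.fst = D ◁ q₁ ≫ k := by
        apply ext
        · rw [reassoc_of% hr1, reassoc_of% (n1 q₁), hk1]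
          simp
        · rw [reassoc_of% hr2, reassoc_of% (n2 q₁), hk2]
          simp
      change (w ≫ r) ≫ b.fst = 𝟙 _ ≫ b.fst
      rw [Category.assoc, this, reassoc_of% hw1, hk1]
      simp
    · obtain ⟨k, hk1, hk2⟩ := desc (0 : b.pt ⟶ B) b.snd
      have : r ≫ b.snd = D ◁ q₂ ≫ k := by
        apply ext
        · rw [reassoc_of% hr1, reassoc_of% (n1 q₂), hk1]
          simp
        · rw [reassoc_of% hr2, reassoc_of% (n2 q₂), hk2]
          simp
      change (w ≫ r) ≫ b.snd = 𝟙 _ ≫ b.snd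
      rw [Category.assoc, this, reassoc_of% hw2, hk2]
      simp
  have huniq : ∀ m m' : b.pt ⟶ T, b.inl ≫ m = b.inl ≫ m' → b.inr ≫ m = b.inr ≫ m' → m = m' := by
    intro m m' h1 h2
    have : r ≫ m = r ≫ m' := by
      apply ext
      · rw [reassoc_of% hr1, reassoc_of% hr1, h1]
      · rw [reassoc_of% hr2, reassoc_of% hr2, h2]
    rw [← Category.id_comp m, ← hwr, Category.assoc, this, ← Category.assoc, hwr, Category.id_comp]
  obtain ⟨k, hk1, hk2⟩ := desc (q₁ ≫ b.fst ≫ f) (q₂ ≫ b.snd ≫ g)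
  have e1 : b.inl ≫ w ≫ k = f := by
    rw [reassoc_of% inl1, hk1, reassoc_of% hA1]
    simp
  have e2 : b.inr ≫ w ≫ k = g := by
    rw [reassoc_of% inr1, hk2, reassoc_of% hB2]
    simp
  exact ⟨w ≫ k, e1, e2, fun m' h1 h2 => huniq _ _ (h1.trans e1.symm) (h2.trans e2.symm)⟩

/-- A compact closed category with finite products has binary biproducts. -/
instance hasBinaryBiproducts : HasBinaryBiproducts C where
  has_binary_biproduct A B :=
    have h := exists_desc_of_isLimit (prodBicone A B) (prodIsProd A B)
    ⟨⟨{
    bicone := prodBicone A B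
    isBilimit := {
      isLimit := prodIsProd A B
      isColimit := BinaryCofan.IsColimit.mk _
        (fun f g => (h _ f g).choose)
        (fun f g => (h _ f g).choose_spec.1)
        (fun f g => (h _ f g).choose_spec.2.1)
        (fun f g m h1 h2 => (h _ f g).choose_spec.2.2 m h1 h2) } }⟩⟩

/-- The additive enrichment determined by the biproducts. -/
instance homAddCommMonoid (X Y : C) : AddCommMonoid (X ⟶ Y) :=
  SemiadditiveOfBinaryBiproducts.addCommMonoidHomOfHasBinaryBiproducts X Y

theorem add_comp' {X Y Z : C} (f g : X ⟶ Y) (h : Y ⟶ Z) : (f + g) ≫ h = f ≫ h + g ≫ h :=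
  SemiadditiveOfBinaryBiproducts.add_comp f g h

theorem comp_add' {X Y Z : C} (f : X ⟶ Y) (g h : Y ⟶ Z) : f ≫ (g + h) = f ≫ g + f ≫ h :=
  SemiadditiveOfBinaryBiproducts.comp_add f g h

end Biproducts

/-! ### States and effects -/

/-- A state of `A*`, obtained by transposing an effect on `A`. -/
def effectToState {A : C} (π : A ⟶ 𝟙_ C) : 𝟙_ C ⟶ dualObj A :=
  cup A ≫ dualObj A ◁ π ≫ (ρ_ (dualObj A)).hom

/-- A state of `A`, obtained by transposing an effect on `A*`. -/
def effectToState' {A : C} (σ : dualObj A ⟶ 𝟙_ C) : 𝟙_ C ⟶ A :=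
  cup A ≫ σ ▷ A ≫ (λ_ A).hom

/-- The product state `ρ ⊗ σ` of `A ⊗ B`. -/
def tensorState {A B : C} (ρ : 𝟙_ C ⟶ A) (σ : 𝟙_ C ⟶ B) : 𝟙_ C ⟶ A ⊗ B :=
  (λ_ (𝟙_ C)).inv ≫ (ρ ⊗ₘ σ)

/-- The product effect `π ⊗ τ` on `A ⊗ B`. -/
def tensorEffect {A B : C} (π : A ⟶ 𝟙_ C) (τ : B ⟶ 𝟙_ C) : A ⊗ B ⟶ 𝟙_ C :=
  (π ⊗ₘ τ) ≫ (λ_ (𝟙_ C)).hom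

/-- The effect on `A ⊗ B` obtained by transposing a state of `A* ⊗ B*`: the wires `A`, `A*` and
the wires `B`, `B*` are joined by caps. -/
def stateToEffect₂ {A B : C} (k : 𝟙_ C ⟶ dualObj A ⊗ dualObj B) : A ⊗ B ⟶ 𝟙_ C :=
  (ρ_ (A ⊗ B)).inv ≫ (A ⊗ B) ◁ k ≫ tensorμ A B (dualObj A) (dualObj B) ≫
    tensorEffect (cap A) (cap B)

theorem tensorState_eq {A B : C} (ρ : 𝟙_ C ⟶ A) (σ : 𝟙_ C ⟶ B) :
    tensorState ρ σ = ρ ≫ (ρ_ A).inv ≫ A ◁ σ := by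
  rw [tensorState, MonoidalCategory.tensorHom_def, unitors_inv_equal,
    rightUnitor_inv_naturality_assoc]

theorem tensorState_eq' {A B : C} (ρ : 𝟙_ C ⟶ A) (σ : 𝟙_ C ⟶ B) :
    tensorState ρ σ = σ ≫ (λ_ B).inv ≫ ρ ▷ B := by
  rw [tensorState, MonoidalCategory.tensorHom_def', leftUnitor_inv_naturality_assoc]

/-- Transposing an effect to a state of the dual and back gives the effect. -/
theorem snake₁ {A : C} (π : A ⟶ 𝟙_ C) :
    (ρ_ A).inv ≫ A ◁ effectToState π ≫ cap A = π := by
  have h := ExactPairing.coevaluation_evaluation (dualObj A) A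
  calc _ = (ρ_ A).inv ≫ A ◁ cup A ≫ (α_ _ _ _).inv ≫ (A ⊗ dualObj A) ◁ π ≫ (ρ_ _).hom ≫ cap A := by
        simp [effectToState]
    _ = (ρ_ A).inv ≫ (A ◁ cup A ≫ (α_ _ _ _).inv ≫ cap A ▷ A) ≫ 𝟙_ C ◁ π ≫ (ρ_ (𝟙_ C)).hom := by
        rw [← rightUnitor_naturality (cap A), whisker_exchange_assoc]
        simp
    _ = π := by
        rw [h, ← unitors_equal]
        simp

/-- Transposing a state to an effect on the dual and back gives the state. -/
theorem snake₂ {A : C} (ρ : 𝟙_ C ⟶ A) :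
    effectToState' ((λ_ (dualObj A)).inv ≫ ρ ▷ dualObj A ≫ cap A) = ρ := by
  have h := ExactPairing.coevaluation_evaluation (dualObj A) A
  calc _ = cup A ≫ (λ_ _).inv ≫ ρ ▷ (dualObj A ⊗ A) ≫ (α_ _ _ _).inv ≫ cap A ▷ A ≫ (λ_ A).hom := by
        simp [effectToState']
    _ = (λ_ (𝟙_ C)).inv ≫ ρ ▷ 𝟙_ C ≫ (A ◁ cup A ≫ (α_ _ _ _).inv ≫ cap A ▷ A) ≫ (λ_ A).hom := by
        rw [leftUnitor_inv_naturality_assoc, whisker_exchange_assoc]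
        simp
    _ = ρ := by
        rw [h, unitors_inv_equal]
        simp

/-- Transposing the product of two transposed effects gives the product effect. -/
theorem stateToEffect₂_tensorState {A B : C} (π : A ⟶ 𝟙_ C) (τ : B ⟶ 𝟙_ C) :
    stateToEffect₂ (tensorState (effectToState π) (effectToState τ)) = tensorEffect π τ := by
  have e : (ρ_ (A ⊗ B)).inv ≫ (A ⊗ B) ◁ (λ_ (𝟙_ C)).inv ≫ tensorμ A B (𝟙_ C) (𝟙_ C) =
      (ρ_ A).inv ⊗ₘ (ρ_ B).inv := by
    rw [Iso.inv_comp_eq, tensor_right_unitality, Category.assoc, Category.assoc,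
      tensorHom_comp_tensorHom, Iso.hom_inv_id, Iso.hom_inv_id, id_tensorHom_id, Category.comp_id]
  rw [stateToEffect₂, tensorState, tensorEffect, MonoidalCategory.whiskerLeft_comp, Category.assoc,
    tensorμ_natural_right_assoc, reassoc_of% e, tensorHom_comp_tensorHom_assoc,
    tensorHom_comp_tensorHom_assoc, Category.assoc, Category.assoc, snake₁, snake₁, tensorEffect]

/-! ### Additive precausal categories -/

variable [HasFiniteProducts C]

variable (C) in
/-- Additive precausal categories: compact closed categories with finite products, equipped with
discarding effects subject to the following conditions. Composition with a scalar `l` on the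
appropriate side is multiplication by `l`. -/
class AdditivePrecausal where
  /-- The discarding effect of each system. -/
  discard : ∀ A : C, A ⟶ 𝟙_ C
  discard_tensor : ∀ A B : C, discard (A ⊗ B) = tensorEffect (discard A) (discard B)
  discard_unit : discard (𝟙_ C) = 𝟙 (𝟙_ C)
  /-- Every two objects have a biproduct `b` such that discarding `b` is `⟨discard, discard⟩`. -/
  discard_biprod : ∀ A B : C, ∃ b : BinaryBicone A B, Nonempty b.IsBilimit ∧
    b.inl ≫ discard b.pt = discard A ∧ b.inr ≫ discard b.pt = discard B
  /-- The dimension of a non-zero system is invertible. -/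
  isIso_dim : ∀ A : C, ¬ IsZero A → IsIso (effectToState' (discard (dualObj A)) ≫ discard A)
  /-- Every system has a finite causal basis. -/
  exists_basis : ∀ A : C, ∃ (n : ℕ) (ρ : Fin n → (𝟙_ C ⟶ A)),
    (∀ i, ρ i ≫ discard A = 𝟙 (𝟙_ C)) ∧
      ∀ (B : C) (f g : A ⟶ B), (∀ i, ρ i ≫ f = ρ i ≫ g) → f = g
  /-- Addition of scalars is cancellative. -/
  scalar_add_cancel : ∀ x y z : 𝟙_ C ⟶ 𝟙_ C, x + z = y + z → x = y
  /-- Scalars are totally pre-ordered. -/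
  scalar_total : ∀ x y : 𝟙_ C ⟶ 𝟙_ C, ∃ z : 𝟙_ C ⟶ 𝟙_ C, x + z = y ∨ x = y + z
  /-- Non-zero scalars are invertible. -/
  scalar_isIso : ∀ x : 𝟙_ C ⟶ 𝟙_ C, x ≠ 0 → IsIso x
  /-- Every effect has a complement with respect to discarding. -/
  exists_complement : ∀ (A : C) (π : A ⟶ 𝟙_ C), ∃ (π' : A ⟶ 𝟙_ C) (l : 𝟙_ C ⟶ 𝟙_ C),
    π + π' = discard A ≫ l

variable [AdditivePrecausal C]

/-- The discarding effect. -/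
def discard (A : C) : A ⟶ 𝟙_ C := AdditivePrecausal.discard A

/-- The uniform state: the transpose of the discarding effect of the dual system. -/
def uniform (A : C) : 𝟙_ C ⟶ A := effectToState' (discard (dualObj A))

/-! ### Dual sets and the category `Caus[C]` -/

/-- The dual `c*` of a set of states of `A`, as a set of effects on `A`. -/
def dual {A : C} (c : Set (𝟙_ C ⟶ A)) : Set (A ⟶ 𝟙_ C) :=
  {π | ∀ ρ ∈ c, ρ ≫ π = 𝟙 (𝟙_ C)}

/-- The dual of a set of effects on `A`, as a set of states of `A`. -/
def dualEff {A : C} (d : Set (A ⟶ 𝟙_ C)) : Set (𝟙_ C ⟶ A) :=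
  {ρ | ∀ π ∈ d, ρ ≫ π = 𝟙 (𝟙_ C)}

/-- The dual `c*` of a set of states of `A`, as a set of states of `A*`. -/
def dualStates {A : C} (c : Set (𝟙_ C ⟶ A)) : Set (𝟙_ C ⟶ dualObj A) :=
  effectToState '' dual c

/-- The dual of a set `d` of states of `A* ⊗ B*`, as a set of states of `A ⊗ B`. -/
def dualStates₂ {A B : C} (d : Set (𝟙_ C ⟶ dualObj A ⊗ dualObj B)) : Set (𝟙_ C ⟶ A ⊗ B) :=
  dualEff (stateToEffect₂ '' d)

/-- A set of states `c` is closed if `c = c**`. -/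
def IsClosedSet {A : C} (c : Set (𝟙_ C ⟶ A)) : Prop :=
  c = dualEff (dual c)

/-- A set of states `c` of `A` is flat if `A` is a zero system, or `c` contains an invertible
multiple of the uniform state and `c*` contains an invertible multiple of discarding. -/
def IsFlat {A : C} (c : Set (𝟙_ C ⟶ A)) : Prop :=
  (∃ l m : 𝟙_ C ⟶ 𝟙_ C, IsIso l ∧ IsIso m ∧ l ≫ uniform A ∈ c ∧ discard A ≫ m ∈ dual c) ∨
    IsZero A

variable (C) in
/-- Objects of `Caus[C]`: systems with a closed and flat set of states. -/
structure Caus where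
  obj : C
  states : Set (𝟙_ C ⟶ obj)
  closed : IsClosedSet states
  flat : IsFlat states

/-- The states of the first-order type on `Z`: those normalised by discarding. -/
def firstOrder (Z : C) : Set (𝟙_ C ⟶ Z) :=
  dualEff {discard Z}

/-- The states of `A ⊗ B`: the double dual of the set of product states. -/
def tensorSet {A B : C} (cA : Set (𝟙_ C ⟶ A)) (cB : Set (𝟙_ C ⟶ B)) : Set (𝟙_ C ⟶ A ⊗ B) :=
  dualEff (dual {h | ∃ ρ ∈ cA, ∃ σ ∈ cB, h = tensorState ρ σ})

/-- The states of `A ⅋ B = (A* ⊗ B*)*`. -/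
def parSet {A B : C} (cA : Set (𝟙_ C ⟶ A)) (cB : Set (𝟙_ C ⟶ B)) : Set (𝟙_ C ⟶ A ⊗ B) :=
  dualStates₂ (tensorSet (dualStates cA) (dualStates cB))

/-- `A ⅋ B` consists of the states that are normalised by all product effects. -/
theorem mem_parSet_iff {A B : C} (cA : Set (𝟙_ C ⟶ A)) (cB : Set (𝟙_ C ⟶ B)) (h : 𝟙_ C ⟶ A ⊗ B) :
    h ∈ parSet cA cB ↔ ∀ π ∈ dual cA, ∀ τ ∈ dual cB, h ≫ tensorEffect π τ = 𝟙 (𝟙_ C) := by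
  constructor
  · intro hh π hπ τ hτ
    rw [← stateToEffect₂_tensorState]
    refine hh _ ⟨_, fun e he => he _ ⟨_, ⟨π, hπ, rfl⟩, _, ⟨τ, hτ, rfl⟩, rfl⟩, rfl⟩
  · rintro hh _ ⟨k, hk, rfl⟩
    have key : ∀ k : 𝟙_ C ⟶ dualObj A ⊗ dualObj B, h ≫ stateToEffect₂ k =
        k ≫ (λ_ _).inv ≫ h ▷ _ ≫ tensorμ A B (dualObj A) (dualObj B) ≫
          tensorEffect (cap A) (cap B) := by
      intro k
      have e := (tensorState_eq h k).symm.trans (tensorState_eq' h k)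
      rw [stateToEffect₂]
      simpa using congrArg (· ≫ tensorμ A B (dualObj A) (dualObj B) ≫
        tensorEffect (cap A) (cap B)) e
    rw [key]
    apply hk
    rintro _ ⟨_, ⟨π, hπ, rfl⟩, _, ⟨τ, hτ, rfl⟩, rfl⟩
    rw [← key, stateToEffect₂_tensorState]
    exact hh π hπ τ hτ

/-- One-way signalling states: an effect on `B` leaves a residual that does not depend on it. -/
def oneWay {A B : C} (cA : Set (𝟙_ C ⟶ A)) (cB : Set (𝟙_ C ⟶ B)) : Set (𝟙_ C ⟶ A ⊗ B) :=
  {h | h ∈ parSet cA cB ∧ ∃ m ∈ cA, ∀ π ∈ dual cB, h ≫ A ◁ π ≫ (ρ_ A).hom = m}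

/-- Composition of a state of `A ⊗ Z` and a state of `Z* ⊗ B` along the cap on `Z`. -/
def compose {A B Z : C} (m : 𝟙_ C ⟶ A ⊗ Z) (n : 𝟙_ C ⟶ dualObj Z ⊗ B) : 𝟙_ C ⟶ A ⊗ B :=
  tensorState m n ≫ (α_ A Z (dualObj Z ⊗ B)).hom ≫ A ◁ (α_ Z (dualObj Z) B).inv ≫
    A ◁ (cap Z ▷ B) ≫ A ◁ (λ_ B).hom

/-- Semi-localisable states: those that factorise through a first-order system. -/
def semiLocal {A B : C} (cA : Set (𝟙_ C ⟶ A)) (cB : Set (𝟙_ C ⟶ B)) : Set (𝟙_ C ⟶ A ⊗ B) :=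
  {h | h ∈ parSet cA cB ∧ ∃ (Z : C), ∃ m ∈ parSet cA (firstOrder Z),
    ∃ n ∈ parSet (dualStates (firstOrder Z)) cB, h = compose m n}

/-- Addition of morphisms is cancellative. -/
theorem add_right_cancel' {A B : C} (f g h : A ⟶ B) (e : f + h = g + h) : f = g := by
  obtain ⟨n, ρ, -, hρ⟩ := AdditivePrecausal.exists_basis A
  obtain ⟨m, μ, -, hμ⟩ := AdditivePrecausal.exists_basis (dualObj B)
  apply hρ
  intro i
  rw [← snake₂ (ρ i ≫ f), ← snake₂ (ρ i ≫ g)]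
  congr 1
  apply hμ
  intro j
  have key : ∀ s : 𝟙_ C ⟶ B, μ j ≫ (λ_ (dualObj B)).inv ≫ s ▷ dualObj B ≫ cap B =
      s ≫ (ρ_ B).inv ≫ B ◁ μ j ≫ cap B := by
    intro s
    have e := (tensorState_eq s (μ j)).symm.trans (tensorState_eq' s (μ j))
    simpa using congrArg (· ≫ cap B) e.symm
  rw [key, key]
  apply AdditivePrecausal.scalar_add_cancel _ _ ((ρ i ≫ h) ≫ (ρ_ B).inv ≫ B ◁ μ j ≫ cap B)
  rw [← add_comp', ← add_comp', ← comp_add', ← comp_add', e]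

/-! ### The subtractive closure -/

/-- Morphisms of the subtractive closure: the group of formal differences of morphisms of `C`.
By `toSub_sub_eq_iff`, `f - g` and `f' - g'` are identified precisely if `f + g' = f' + g`. -/
abbrev SubHom (X Y : C) : Type v := Algebra.GrothendieckAddGroup (X ⟶ Y)

/-- The embedding of `C` into its subtractive closure. -/
abbrev toSub {X Y : C} : (X ⟶ Y) →+ SubHom X Y := Algebra.GrothendieckAddGroup.of

theorem toSub_sub_eq_iff {X Y : C} (f g f' g' : X ⟶ Y) :
    toSub f - toSub g = toSub f' - toSub g' ↔ f + g' = f' + g := by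
  have : IsCancelAdd (X ⟶ Y) :=
    { add_right_cancel := fun a b c e => add_right_cancel' b c a e
      add_left_cancel := fun a b c e =>
        add_right_cancel' b c a (by rw [add_comm b, add_comm c]; exact e) }
  rw [sub_eq_sub_iff_add_eq_add, ← map_add, ← map_add]
  exact Algebra.GrothendieckAddGroup.of_injective.eq_iff

/-- The tensor product of states as a biadditive map. -/
def tensorStateHom (A B : C) : (𝟙_ C ⟶ A) →+ (𝟙_ C ⟶ B) →+ (𝟙_ C ⟶ A ⊗ B) where
  toFun ρ :=
    { toFun := fun σ => tensorState ρ σ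
      map_zero' := by rw [tensorState_eq']; exact zero_comp
      map_add' := fun σ τ => by simp only [tensorState_eq', add_comp'] }
  map_zero' := by
    ext σ
    change tensorState 0 σ = 0
    rw [tensorState_eq]
    exact zero_comp
  map_add' ρ τ := by
    ext σ
    change tensorState (ρ + τ) σ = tensorState ρ σ + tensorState τ σ
    simp only [tensorState_eq, add_comp']

/-- The tensor product of states in the subtractive closure: the biadditive extension of the
tensor product of states in `C`. -/
def subTensor (A B : C) : SubHom (𝟙_ C) A →+ SubHom (𝟙_ C) B →+ SubHom (𝟙_ C) (A ⊗ B) :=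
  AddMonoidHom.flip (Algebra.GrothendieckAddGroup.lift (AddMonoidHom.flip
    (Algebra.GrothendieckAddGroup.lift ((AddMonoidHom.compHom toSub).comp (tensorStateHom A B)))))

theorem subTensor_toSub {A B : C} (ρ : 𝟙_ C ⟶ A) (σ : 𝟙_ C ⟶ B) :
    subTensor A B (toSub ρ) (toSub σ) = toSub (tensorState ρ σ) := by
  have h1 : ∀ {M G : Type v} [AddCommMonoid M] [AddCommGroup G] (φ : M →+ G) (x : M),
      Algebra.GrothendieckAddGroup.lift φ (Algebra.GrothendieckAddGroup.of x) = φ x := by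
    intro M G _ _ φ x
    exact DFunLike.congr_fun (Algebra.GrothendieckAddGroup.lift.left_inv φ) x
  rw [subTensor, AddMonoidHom.flip_apply, h1, AddMonoidHom.flip_apply, h1]
  rfl

/-- States `h` of `A ⅋ B` with `h = ∑ i, fᵢ ⊗ gᵢ` in the subtractive closure, where every `gᵢ` is
in `cB` and `∑ i, fᵢ` is in `cA`. -/
def coherenceSeq {A B : C} (cA : Set (𝟙_ C ⟶ A)) (cB : Set (𝟙_ C ⟶ B)) :
    Set (𝟙_ C ⟶ A ⊗ B) :=
  {h | h ∈ parSet cA cB ∧ ∃ (n : ℕ) (f : Fin n → SubHom (𝟙_ C) A) (g : Fin n → (𝟙_ C ⟶ B)),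
    (∀ i, g i ∈ cB) ∧ ∃ f₀ ∈ cA, toSub h = ∑ i, subTensor A B (f i) (toSub (g i)) ∧
      toSub f₀ = ∑ i, f i}

end HigherOrder

end

open HigherOrder

/-!
A state `h` of `A ⊗ B` is one-way signalling if the state of `A` that it leaves for a normalised
effect on `B` is independent of this effect. All four descriptions are compared with the set
`oneWayEffects cA cB` of effects `k` on `A ⊗ B` that leave the same element of `dual cA` for every
state in `cB`; by transposition (`image_oneWay_dualStates`) these are the one-way signalling states
of the dual types.

Two facts carry the argument. Product effects separate states of `A ⊗ B`, and product states
separate morphisms out of `A ⊗ B` (`tensor_state_ext`, `tensor_hom_ext`). Moreover discarding and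
the uniform state are interior points of the cones of effects and states
(`exists_smul_add_eq_discard`, `exists_smul_add_eq_uniform`); as flatness puts multiples of them
into `dual cB` and `cA`, any effect or state occurs, up to an invertible scalar, as a summand of a
normalised one.

* `oneWay_subset_coherenceSeq`: the partial state `h(-, τ)` is linear in `τ`, and by the interior
  point `discard` it depends only on the values of `τ` on `cB`. In the subtractive closure the
  scalars form a field and effects form a finite-dimensional space, hence finitely many `gᵢ` in `cB`
  suffice, `h = ∑ fᵢ ⊗ gᵢ`, and `∑ fᵢ` is the partial state at any normalised effect. The converse
  `coherenceSeq_subset_oneWay` is a direct computation.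
* `oneWay_eq_dualEff_oneWayEffects`: if `k` leaves `π` for every `gᵢ`, then `k` takes the value
  `π (∑ fᵢ) = 1` on `∑ fᵢ ⊗ gᵢ`. Conversely, a product effect `φ ⊗ τ` may be exchanged for `φ ⊗ τ'`
  inside an element of `oneWayEffects`, so that states normalised by these effects do not
  distinguish `τ` from `τ'`.
* `dual_semiLocal_subset`, `semiLocal_subset_oneWay`: the states `f₁ ⊗ g₁ + f₂ ⊗ g₂` with `f₁ + f₂`
  in `cA` factorise through the classical bit `𝟙_ C ⊞ 𝟙_ C`, and effects normalised on these already
  are in `oneWayEffects`.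

Zero objects, for which flatness gives no information, are treated separately.
-/

noncomputable section

namespace HigherOrder

/-! ### Transposition and partial evaluation -/

section Transposition

variable {C : Type u} [Category.{v} C] [MonoidalCategory C] [SymmetricCategory C]
  [LeftRigidCategory C]

/-- The effect on `A*` obtained by transposing a state of `A`. -/
def stateToEffect {A : C} (ρ : 𝟙_ C ⟶ A) : dualObj A ⟶ 𝟙_ C :=
  (λ_ (dualObj A)).inv ≫ ρ ▷ dualObj A ≫ cap A

/-- The state of `A` that an effect on `B` leaves of a state of `A ⊗ B`. -/
def partialState {A B : C} (h : 𝟙_ C ⟶ A ⊗ B) (τ : B ⟶ 𝟙_ C) : 𝟙_ C ⟶ A :=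
  h ≫ A ◁ τ ≫ (ρ_ A).hom

/-- The effect on `A` that a state of `B` leaves of an effect on `A ⊗ B`. -/
def partialEffect {A B : C} (k : A ⊗ B ⟶ 𝟙_ C) (σ : 𝟙_ C ⟶ B) : A ⟶ 𝟙_ C :=
  (ρ_ A).inv ≫ A ◁ σ ≫ k

theorem comp_stateToEffect {A : C} (μ : 𝟙_ C ⟶ dualObj A) (ρ : 𝟙_ C ⟶ A) :
    μ ≫ stateToEffect ρ = ρ ≫ (ρ_ A).inv ≫ A ◁ μ ≫ cap A := by
  have e := (tensorState_eq ρ μ).symm.trans (tensorState_eq' ρ μ)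
  simpa [stateToEffect] using congrArg (· ≫ cap A) e.symm

theorem effectToState_comp_stateToEffect {A : C} (π : A ⟶ 𝟙_ C) (ρ : 𝟙_ C ⟶ A) :
    effectToState π ≫ stateToEffect ρ = ρ ≫ π := by
  rw [comp_stateToEffect, snake₁]

theorem effectToState'_stateToEffect {A : C} (ρ : 𝟙_ C ⟶ A) :
    effectToState' (stateToEffect ρ) = ρ :=
  snake₂ ρ

theorem stateToEffect_effectToState' {A : C} (σ : dualObj A ⟶ 𝟙_ C) :
    stateToEffect (effectToState' σ) = σ := by
  have h := ExactPairing.evaluation_coevaluation (dualObj A) A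
  calc _ = (λ_ _).inv ≫ cup A ▷ dualObj A ≫ (α_ _ _ _).hom ≫ σ ▷ (A ⊗ dualObj A) ≫
          (λ_ _).hom ≫ cap A := by
        simp [effectToState', stateToEffect]
    _ = (λ_ _).inv ≫ (cup A ▷ dualObj A ≫ (α_ _ _ _).hom ≫ dualObj A ◁ cap A) ≫
          σ ▷ 𝟙_ C ≫ (λ_ _).hom := by
        rw [← leftUnitor_naturality, ← whisker_exchange_assoc]
        simp
    _ = σ := by
        rw [h, unitors_equal]
        simp

theorem scalar_comm (x y : 𝟙_ C ⟶ 𝟙_ C) : x ≫ y = y ≫ x := by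
  have e := (tensorState_eq x y).symm.trans (tensorState_eq' x y)
  have e' := congrArg (· ≫ (λ_ (𝟙_ C)).hom) e
  simpa [← unitors_equal, ← unitors_inv_equal] using e'

theorem tensorState_smul_left {A B : C} (x : 𝟙_ C ⟶ 𝟙_ C) (ρ : 𝟙_ C ⟶ A) (σ : 𝟙_ C ⟶ B) :
    tensorState (x ≫ ρ) σ = x ≫ tensorState ρ σ := by
  simp only [tensorState_eq, Category.assoc]

theorem tensorState_comp_tensorEffect {A B : C} (ρ : 𝟙_ C ⟶ A) (σ : 𝟙_ C ⟶ B)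
    (π : A ⟶ 𝟙_ C) (τ : B ⟶ 𝟙_ C) :
    tensorState ρ σ ≫ tensorEffect π τ = (ρ ≫ π) ≫ σ ≫ τ := by
  rw [tensorState_eq, tensorEffect, MonoidalCategory.tensorHom_def, Category.assoc, Category.assoc,
    Category.assoc, whisker_exchange_assoc, leftUnitor_naturality, leftUnitor_naturality_assoc,
    unitors_equal, rightUnitor_naturality_assoc, Iso.inv_hom_id_assoc, Category.assoc]

theorem partialState_comp {A B : C} (h : 𝟙_ C ⟶ A ⊗ B) (π : A ⟶ 𝟙_ C) (τ : B ⟶ 𝟙_ C) :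
    partialState h τ ≫ π = h ≫ tensorEffect π τ := by
  rw [partialState, tensorEffect, MonoidalCategory.tensorHom_def', unitors_equal]
  simp

theorem comp_partialEffect {A B : C} (k : A ⊗ B ⟶ 𝟙_ C) (ρ : 𝟙_ C ⟶ A) (σ : 𝟙_ C ⟶ B) :
    ρ ≫ partialEffect k σ = tensorState ρ σ ≫ k := by
  simp only [partialEffect, tensorState_eq, Category.assoc]

/-- Evaluating a transposed state of `A* ⊗ B*` on a product state is evaluating the product of the
transposed effects on it. -/
theorem tensorState_comp_stateToEffect₂ {A B : C} (k : 𝟙_ C ⟶ dualObj A ⊗ dualObj B)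
    (ρ : 𝟙_ C ⟶ A) (σ : 𝟙_ C ⟶ B) :
    tensorState ρ σ ≫ stateToEffect₂ k =
      k ≫ tensorEffect (stateToEffect ρ) (stateToEffect σ) := by
  have e := (tensorState_eq (tensorState ρ σ) k).symm.trans (tensorState_eq' (tensorState ρ σ) k)
  have e' : (λ_ (dualObj A ⊗ dualObj B)).inv ≫ (λ_ (𝟙_ C)).inv ▷ _ ≫
      tensorμ (𝟙_ C) (𝟙_ C) (dualObj A) (dualObj B) =
      (λ_ (dualObj A)).inv ⊗ₘ (λ_ (dualObj B)).inv := by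
    rw [Iso.inv_comp_eq, tensor_left_unitality, Category.assoc, Category.assoc,
      tensorHom_comp_tensorHom, Iso.hom_inv_id, Iso.hom_inv_id, id_tensorHom_id, Category.comp_id]
  calc _ = k ≫ (λ_ _).inv ≫ tensorState ρ σ ▷ _ ≫ tensorμ A B (dualObj A) (dualObj B) ≫
          tensorEffect (cap A) (cap B) := by
        rw [stateToEffect₂]
        simpa using congrArg (· ≫ tensorμ A B (dualObj A) (dualObj B) ≫
          tensorEffect (cap A) (cap B)) e
    _ = _ := by
        rw [tensorState, comp_whiskerRight, Category.assoc, tensorμ_natural_left_assoc,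
          reassoc_of% e', tensorEffect, tensorHom_comp_tensorHom_assoc,
          tensorHom_comp_tensorHom_assoc, tensorEffect, stateToEffect, stateToEffect,
          Category.assoc, Category.assoc]

theorem tensorState_comp_whiskerLeft {A B B' : C} (ρ : 𝟙_ C ⟶ A) (σ : 𝟙_ C ⟶ B) (x : B ⟶ B') :
    tensorState ρ σ ≫ A ◁ x = tensorState ρ (σ ≫ x) := by
  simp [tensorState_eq]

theorem tensorState_smul_right {A B : C} (x : 𝟙_ C ⟶ 𝟙_ C) (ρ : 𝟙_ C ⟶ A) (σ : 𝟙_ C ⟶ B) :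
    tensorState ρ (x ≫ σ) = x ≫ tensorState ρ σ := by
  simp only [tensorState_eq', Category.assoc]

/-- The morphism `Z ⟶ B` obtained by transposing a state of `Z* ⊗ B`. -/
def stateToHom {Z B : C} (n : 𝟙_ C ⟶ dualObj Z ⊗ B) : Z ⟶ B :=
  (ρ_ Z).inv ≫ Z ◁ n ≫ (α_ Z (dualObj Z) B).inv ≫ cap Z ▷ B ≫ (λ_ B).hom

/-- Composition along the cap on `Z` is composition with a morphism out of `Z`. -/
theorem compose_eq {A B Z : C} (m : 𝟙_ C ⟶ A ⊗ Z) (n : 𝟙_ C ⟶ dualObj Z ⊗ B) :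
    compose m n = m ≫ A ◁ stateToHom n := by
  simp [compose, stateToHom, tensorState_eq]

/-- The effect `stateToHom n ≫ τ` on `Z` is the transpose of the partial state of `n` at `τ`. -/
theorem stateToHom_comp {Z B : C} (n : 𝟙_ C ⟶ dualObj Z ⊗ B) (τ : B ⟶ 𝟙_ C) :
    stateToHom n ≫ τ = (ρ_ Z).inv ≫ Z ◁ partialState n τ ≫ cap Z := by
  have e : cap Z ▷ B ≫ (λ_ B).hom ≫ τ =
      (Z ⊗ dualObj Z) ◁ τ ≫ (ρ_ _).hom ≫ cap Z := by
    rw [← rightUnitor_naturality (cap Z), whisker_exchange_assoc, ← leftUnitor_naturality,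
      unitors_equal]
  simp [stateToHom, partialState, e]

theorem stateToHom_tensorState {Z B : C} (π : Z ⟶ 𝟙_ C) (g : 𝟙_ C ⟶ B) :
    stateToHom (tensorState (effectToState π) g) = π ≫ g := by
  have e : (Z ⊗ dualObj Z) ◁ g ≫ cap Z ▷ B ≫ (λ_ B).hom = (ρ_ _).hom ≫ cap Z ≫ g := by
    rw [whisker_exchange_assoc, leftUnitor_naturality, unitors_equal,
      rightUnitor_naturality_assoc]
  have e' : Z ◁ dualObj Z ◁ g ≫ (α_ Z (dualObj Z) B).inv ≫ cap Z ▷ B ≫ (λ_ B).hom =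
      Z ◁ (ρ_ (dualObj Z)).hom ≫ cap Z ≫ g := by
    rw [associator_inv_naturality_right_assoc, e]
    simp
  conv_rhs => rw [← snake₁ π]
  simp only [stateToHom, tensorState_eq, MonoidalCategory.whiskerLeft_comp, Category.assoc, e',
    whiskerLeft_inv_hom_assoc]

theorem compose_tensorState {A B Z : C} (f : 𝟙_ C ⟶ A) (z : 𝟙_ C ⟶ Z) (π : Z ⟶ 𝟙_ C)
    (g : 𝟙_ C ⟶ B) :
    compose (tensorState f z) (tensorState (effectToState π) g) =
      (z ≫ π) ≫ tensorState f g := by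
  rw [compose_eq, stateToHom_tensorState, tensorState_comp_whiskerLeft, ← Category.assoc,
    tensorState_smul_right]

theorem partialState_compose {A B Z : C} (m : 𝟙_ C ⟶ A ⊗ Z) (n : 𝟙_ C ⟶ dualObj Z ⊗ B)
    {ζ : Z ⟶ 𝟙_ C} {τ : B ⟶ 𝟙_ C} (hn : partialState n τ = effectToState ζ) :
    partialState (compose m n) τ = partialState m ζ := by
  have e : stateToHom n ≫ τ = ζ := by rw [stateToHom_comp, hn, snake₁]
  rw [compose_eq, partialState, partialState, Category.assoc, ← e,
    MonoidalCategory.whiskerLeft_comp, Category.assoc]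

/-- Every effect on `A ⊗ B` is the transpose of a state of `A* ⊗ B*`, up to its values on product
states. -/
theorem exists_tensorState_comp_stateToEffect₂ {A B : C} (k : A ⊗ B ⟶ 𝟙_ C) :
    ∃ l : 𝟙_ C ⟶ dualObj A ⊗ dualObj B, ∀ (ρ : 𝟙_ C ⟶ A) (σ : 𝟙_ C ⟶ B),
      tensorState ρ σ ≫ stateToEffect₂ l = tensorState ρ σ ≫ k := by
  let φ : B ⟶ dualObj A :=
    (λ_ B).inv ≫ cup A ▷ B ≫ (α_ _ _ _).hom ≫ dualObj A ◁ k ≫ (ρ_ _).hom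
  have hφ : ∀ σ : 𝟙_ C ⟶ B, σ ≫ φ = effectToState (partialEffect k σ) := by
    intro σ
    have e : (ρ_ (𝟙_ C)).inv ≫ 𝟙_ C ◁ σ ≫ cup A ▷ B = cup A ≫ (ρ_ _).inv ≫ _ ◁ σ := by
      rw [whisker_exchange, rightUnitor_inv_naturality_assoc]
    calc σ ≫ φ = ((ρ_ (𝟙_ C)).inv ≫ 𝟙_ C ◁ σ ≫ cup A ▷ B) ≫ (α_ _ _ _).hom ≫
            dualObj A ◁ k ≫ (ρ_ _).hom := by
          simp only [φ, leftUnitor_inv_naturality_assoc, unitors_inv_equal, Category.assoc]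
      _ = _ := by
          rw [e]
          simp [effectToState, partialEffect]
  refine ⟨cup B ≫ dualObj B ◁ φ ≫ (β_ _ _).hom, fun ρ σ => ?_⟩
  have e : dualObj B ◁ φ ≫ (β_ _ _).hom ≫ tensorEffect (stateToEffect ρ) (stateToEffect σ) =
      stateToEffect σ ▷ B ≫ (λ_ B).hom ≫ φ ≫ stateToEffect ρ := by
    rw [tensorEffect, ← BraidedCategory.braiding_naturality_assoc, braiding_leftUnitor,
      ← unitors_equal, MonoidalCategory.tensorHom_def, Category.assoc, whisker_exchange_assoc,
      leftUnitor_naturality, leftUnitor_naturality_assoc]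
  rw [tensorState_comp_stateToEffect₂, Category.assoc, Category.assoc, e,
    ← comp_partialEffect,
    ← effectToState_comp_stateToEffect (partialEffect k σ), ← hφ]
  conv_rhs => rw [← snake₂ σ]
  simp [effectToState', stateToEffect]

end Transposition

/-! ### Local tomography and interior points -/

section LocalTomography

variable {C : Type u} [Category.{v} C] [MonoidalCategory C] [SymmetricCategory C]
  [LeftRigidCategory C] [HasFiniteProducts C] [AdditivePrecausal C]

theorem hom_ext_states {A B : C} {f g : A ⟶ B} (e : ∀ ρ : 𝟙_ C ⟶ A, ρ ≫ f = ρ ≫ g) : f = g := by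
  obtain ⟨n, ρ, -, hρ⟩ := AdditivePrecausal.exists_basis A
  exact hρ _ _ _ fun i => e (ρ i)

/-- States are determined by effects: by transposition, this is the existence of a basis of `A*`. -/
theorem state_ext {A : C} {s t : 𝟙_ C ⟶ A} (e : ∀ π : A ⟶ 𝟙_ C, s ≫ π = t ≫ π) : s = t := by
  rw [← effectToState'_stateToEffect s, ← effectToState'_stateToEffect t]
  congr 1
  apply hom_ext_states
  intro μ
  rw [comp_stateToEffect, comp_stateToEffect, e]

theorem state_dual_ext {A : C} {s t : 𝟙_ C ⟶ dualObj A}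
    (e : ∀ ρ : 𝟙_ C ⟶ A, s ≫ stateToEffect ρ = t ≫ stateToEffect ρ) : s = t := by
  apply state_ext
  intro π
  rw [← stateToEffect_effectToState' π, e]

/-- Morphisms out of `A ⊗ B` are determined by product states. -/
theorem tensor_hom_ext {A B X : C} {f g : A ⊗ B ⟶ X}
    (e : ∀ (ρ : 𝟙_ C ⟶ A) (σ : 𝟙_ C ⟶ B), tensorState ρ σ ≫ f = tensorState ρ σ ≫ g) :
    f = g := by
  let := swapPairing A
  apply (tensorLeftHomEquiv B (dualObj A) A X).injective
  apply hom_ext_states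
  intro σ
  apply (tensorLeftHomEquiv (𝟙_ C) (dualObj A) A X).symm.injective
  rw [tensorLeftHomEquiv_symm_naturality, tensorLeftHomEquiv_symm_naturality,
    Equiv.symm_apply_apply, Equiv.symm_apply_apply, ← cancel_epi (ρ_ A).inv]
  apply hom_ext_states
  intro ρ
  simpa only [tensorState_eq, Category.assoc] using e ρ σ

/-- States of `A ⊗ B` are determined by product effects. -/
theorem tensor_state_ext {A B : C} {h k : 𝟙_ C ⟶ A ⊗ B}
    (e : ∀ (π : A ⟶ 𝟙_ C) (τ : B ⟶ 𝟙_ C), h ≫ tensorEffect π τ = k ≫ tensorEffect π τ) :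
    h = k := by
  let := swapPairing A
  apply (tensorLeftHomEquiv (𝟙_ C) A (dualObj A) B).symm.injective
  apply hom_ext_states
  intro μ
  apply state_ext
  intro τ
  rw [Category.assoc, Category.assoc]
  congr 1
  apply (tensorLeftHomEquiv (𝟙_ C) A (dualObj A) (𝟙_ C)).injective
  rw [tensorLeftHomEquiv_naturality, tensorLeftHomEquiv_naturality,
    Equiv.apply_symm_apply, Equiv.apply_symm_apply, ← cancel_mono (ρ_ A).hom]
  apply state_ext
  intro π
  simpa only [← partialState_comp, partialState, Category.assoc] using e π τ

theorem stateToEffect₂_surjective (A B : C) :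
    Function.Surjective (stateToEffect₂ : (𝟙_ C ⟶ dualObj A ⊗ dualObj B) → (A ⊗ B ⟶ 𝟙_ C)) :=
  fun k =>
    let ⟨l, hl⟩ := exists_tensorState_comp_stateToEffect₂ k
    ⟨l, tensor_hom_ext hl⟩

theorem tensorEffect_add_right {A B : C} (π : A ⟶ 𝟙_ C) (τ τ' : B ⟶ 𝟙_ C) :
    tensorEffect π (τ + τ') = tensorEffect π τ + tensorEffect π τ' := by
  apply tensor_hom_ext
  intro ρ σ
  simp only [comp_add', tensorState_comp_tensorEffect]

theorem tensorEffect_zero_right {A B : C} (π : A ⟶ 𝟙_ C) :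
    tensorEffect π (0 : B ⟶ 𝟙_ C) = 0 := by
  apply tensor_hom_ext
  intro ρ σ
  rw [tensorState_comp_tensorEffect, comp_zero, comp_zero, comp_zero]

theorem tensorEffect_smul_right {A B : C} (π : A ⟶ 𝟙_ C) (τ : B ⟶ 𝟙_ C) (x : 𝟙_ C ⟶ 𝟙_ C) :
    tensorEffect π (τ ≫ x) = tensorEffect π τ ≫ x := by
  apply tensor_hom_ext
  intro ρ σ
  simp only [tensorState_comp_tensorEffect, ← Category.assoc]

theorem partialState_add {A B : C} (h : 𝟙_ C ⟶ A ⊗ B) (τ τ' : B ⟶ 𝟙_ C) :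
    partialState h (τ + τ') = partialState h τ + partialState h τ' := by
  apply state_ext
  intro π
  simp only [add_comp', partialState_comp, tensorEffect_add_right, comp_add']

theorem partialState_zero {A B : C} (h : 𝟙_ C ⟶ A ⊗ B) :
    partialState h (0 : B ⟶ 𝟙_ C) = 0 := by
  apply state_ext
  intro π
  rw [partialState_comp, tensorEffect_zero_right, comp_zero, zero_comp]

theorem partialState_smul {A B : C} (h : 𝟙_ C ⟶ A ⊗ B) (τ : B ⟶ 𝟙_ C) (x : 𝟙_ C ⟶ 𝟙_ C) :
    partialState h (τ ≫ x) = x ≫ partialState h τ := by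
  apply state_ext
  intro π
  rw [Category.assoc, partialState_comp, partialState_comp, tensorEffect_smul_right,
    ← Category.assoc, scalar_comm]

theorem partialEffect_add {A B : C} (k l : A ⊗ B ⟶ 𝟙_ C) (σ : 𝟙_ C ⟶ B) :
    partialEffect (k + l) σ = partialEffect k σ + partialEffect l σ := by
  simp only [partialEffect, comp_add']

theorem partialEffect_tensorEffect_comp {A B : C} (π : A ⟶ 𝟙_ C) (τ : B ⟶ 𝟙_ C)
    (x : 𝟙_ C ⟶ 𝟙_ C) (σ : 𝟙_ C ⟶ B) :
    partialEffect (tensorEffect π τ ≫ x) σ = π ≫ (σ ≫ τ) ≫ x := by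
  apply hom_ext_states
  intro ρ
  rw [comp_partialEffect, ← Category.assoc, tensorState_comp_tensorEffect]
  simp only [Category.assoc]

theorem tensorState_add_left {A B : C} (ρ ρ' : 𝟙_ C ⟶ A) (σ : 𝟙_ C ⟶ B) :
    tensorState (ρ + ρ') σ = tensorState ρ σ + tensorState ρ' σ := by
  simp only [tensorState_eq, add_comp']

theorem tensorState_add_right {A B : C} (ρ : 𝟙_ C ⟶ A) (σ σ' : 𝟙_ C ⟶ B) :
    tensorState ρ (σ + σ') = tensorState ρ σ + tensorState ρ σ' := by
  simp only [tensorState_eq', add_comp']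

/-- The cone of effects on `A` has discarding in its interior: an invertible multiple of any
effect is dominated by a given invertible multiple of discarding. -/
theorem exists_smul_add_eq_discard {A : C} (π : A ⟶ 𝟙_ C) (m : 𝟙_ C ⟶ 𝟙_ C) [IsIso m] :
    ∃ (t : 𝟙_ C ⟶ 𝟙_ C) (π' : A ⟶ 𝟙_ C), IsIso t ∧ π ≫ t + π' = discard A ≫ m := by
  obtain ⟨π', l, h⟩ := AdditivePrecausal.exists_complement A π
  by_cases hl : l = 0
  · refine ⟨𝟙 _, π' + discard A ≫ m, inferInstance, ?_⟩
    rw [hl, comp_zero] at h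
    rw [Category.comp_id, ← add_assoc, h, zero_add]
  · have := AdditivePrecausal.scalar_isIso l hl
    refine ⟨inv l ≫ m, π' ≫ inv l ≫ m, inferInstance, ?_⟩
    rw [← add_comp', h, discard]
    simp

/-- The cone of states of `A` has the uniform state in its interior. -/
theorem exists_smul_add_eq_uniform {A : C} (ρ : 𝟙_ C ⟶ A) (m : 𝟙_ C ⟶ 𝟙_ C) [IsIso m] :
    ∃ (t : 𝟙_ C ⟶ 𝟙_ C) (ρ' : 𝟙_ C ⟶ A), IsIso t ∧ t ≫ ρ + ρ' = m ≫ uniform A := by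
  obtain ⟨t, σ, ht, h⟩ := exists_smul_add_eq_discard (stateToEffect ρ) m
  refine ⟨t, effectToState' σ, ht, state_ext fun π => ?_⟩
  have e : ∀ σ : dualObj A ⟶ 𝟙_ C, effectToState π ≫ σ = effectToState' σ ≫ π := fun σ => by
    conv_lhs => rw [← stateToEffect_effectToState' σ]
    rw [effectToState_comp_stateToEffect]
  have h' := congrArg (effectToState π ≫ ·) h
  simp only [comp_add'] at h'
  rw [← Category.assoc, ← Category.assoc, effectToState_comp_stateToEffect, e, e] at h'
  rw [add_comp', Category.assoc, Category.assoc, scalar_comm t, scalar_comm m]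
  exact h'

end LocalTomography

/-! ### One-way signalling and semi-localisable states -/

section OneWaySignalling

variable {C : Type u} [Category.{v} C] [MonoidalCategory C] [SymmetricCategory C]
  [LeftRigidCategory C] [HasFiniteProducts C] [AdditivePrecausal C]

/-- The effects on `A ⊗ B` that leave the same normalised effect on `A` for every state in `cB`:
the one-way signalling states of the dual types, regarded as effects. -/
def oneWayEffects {A B : C} (cA : Set (𝟙_ C ⟶ A)) (cB : Set (𝟙_ C ⟶ B)) : Set (A ⊗ B ⟶ 𝟙_ C) :=
  {k | ∃ π ∈ dual cA, ∀ σ ∈ cB, partialEffect k σ = π}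

theorem mem_of_normalised {A : C} {c : Set (𝟙_ C ⟶ A)} (hc : IsClosedSet c) {ρ : 𝟙_ C ⟶ A}
    (h : ∀ π ∈ dual c, ρ ≫ π = 𝟙 (𝟙_ C)) : ρ ∈ c := by
  rw [hc]
  exact h

/-- The signalling condition implies membership in `parSet cA cB`. -/
theorem mem_oneWay_iff {A B : C} {cA : Set (𝟙_ C ⟶ A)} {cB : Set (𝟙_ C ⟶ B)}
    {h : 𝟙_ C ⟶ A ⊗ B} :
    h ∈ oneWay cA cB ↔ ∃ m ∈ cA, ∀ τ ∈ dual cB, partialState h τ = m := by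
  refine ⟨And.right, fun ⟨m, hm, e⟩ => ⟨?_, m, hm, e⟩⟩
  rw [mem_parSet_iff]
  intro π hπ τ hτ
  rw [← partialState_comp, e τ hτ, hπ m hm]

theorem partialState_mem {A B : C} {cA : Set (𝟙_ C ⟶ A)} {cB : Set (𝟙_ C ⟶ B)}
    (hA : IsClosedSet cA) {h : 𝟙_ C ⟶ A ⊗ B} (hh : h ∈ parSet cA cB) {τ : B ⟶ 𝟙_ C}
    (hτ : τ ∈ dual cB) : partialState h τ ∈ cA := by
  rw [mem_parSet_iff] at hh
  refine mem_of_normalised hA fun π hπ => ?_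
  rw [partialState_comp, hh π hπ τ hτ]

theorem effectToState_mem {A : C} {c : Set (𝟙_ C ⟶ A)} {π : A ⟶ 𝟙_ C} (h : π ∈ dual c) :
    effectToState π ∈ dualStates c :=
  ⟨π, h, rfl⟩

theorem stateToEffect_mem_dual {A : C} {c : Set (𝟙_ C ⟶ A)} {ρ : 𝟙_ C ⟶ A} (h : ρ ∈ c) :
    stateToEffect ρ ∈ dual (dualStates c) := by
  rintro _ ⟨π, hπ, rfl⟩
  rw [effectToState_comp_stateToEffect, hπ ρ h]

theorem exists_stateToEffect_of_mem_dual {A : C} {c : Set (𝟙_ C ⟶ A)} (hc : IsClosedSet c)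
    {μ : dualObj A ⟶ 𝟙_ C} (h : μ ∈ dual (dualStates c)) : ∃ ρ ∈ c, stateToEffect ρ = μ := by
  refine ⟨effectToState' μ, mem_of_normalised hc fun π hπ => ?_, stateToEffect_effectToState' μ⟩
  rw [← effectToState_comp_stateToEffect, stateToEffect_effectToState',
    h _ (effectToState_mem hπ)]

/-- Transposition identifies the one-way signalling states of the dual types with
`oneWayEffects`. -/
theorem image_oneWay_dualStates {A B : C} {cA : Set (𝟙_ C ⟶ A)} {cB : Set (𝟙_ C ⟶ B)}
    (hB : IsClosedSet cB) :
    stateToEffect₂ '' oneWay (dualStates cA) (dualStates cB) = oneWayEffects cA cB := by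
  have key : ∀ (k : 𝟙_ C ⟶ dualObj A ⊗ dualObj B) (σ : 𝟙_ C ⟶ B),
      partialState k (stateToEffect σ) = effectToState (partialEffect (stateToEffect₂ k) σ) := by
    intro k σ
    apply state_dual_ext
    intro ρ
    rw [partialState_comp, ← tensorState_comp_stateToEffect₂, effectToState_comp_stateToEffect,
      comp_partialEffect]
  ext k
  constructor
  · rintro ⟨k, hk, rfl⟩
    obtain ⟨_, ⟨π, hπ, rfl⟩, e⟩ := mem_oneWay_iff.1 hk
    refine ⟨π, hπ, fun σ hσ => ?_⟩
    rw [← snake₁ (partialEffect _ _), ← key, e _ (stateToEffect_mem_dual hσ), snake₁]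
  · obtain ⟨k, rfl⟩ := stateToEffect₂_surjective A B k
    rintro ⟨π, hπ, e⟩
    refine ⟨k, mem_oneWay_iff.2 ⟨_, effectToState_mem hπ, fun μ hμ => ?_⟩, rfl⟩
    obtain ⟨σ, hσ, rfl⟩ := exists_stateToEffect_of_mem_dual hB hμ
    rw [key, e σ hσ]

theorem mem_dual_firstOrder (Z : C) : discard Z ∈ dual (firstOrder Z) :=
  fun _ h => h _ rfl

/-- Discarding is the only effect normalised by all causal states, as these form a basis. -/
theorem eq_discard_of_mem_dual {Z : C} {ζ : Z ⟶ 𝟙_ C} (h : ζ ∈ dual (firstOrder Z)) :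
    ζ = discard Z := by
  obtain ⟨n, ρ, h1, h2⟩ := AdditivePrecausal.exists_basis Z
  apply h2
  intro i
  rw [discard, h1 i]
  refine h _ ?_
  rintro _ rfl
  exact h1 i

theorem isClosedSet_firstOrder (Z : C) : IsClosedSet (firstOrder Z) := by
  apply Set.Subset.antisymm
  · exact fun ρ hρ π hπ => hπ ρ hρ
  · rintro ρ hρ _ rfl
    exact hρ _ (mem_dual_firstOrder Z)

/-- A state composed through a first-order system is one-way signalling: normalised effects on `B`
act on the first-order system as discarding. -/
theorem semiLocal_subset_oneWay {A B : C} {cA : Set (𝟙_ C ⟶ A)} {cB : Set (𝟙_ C ⟶ B)}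
    (hA : IsClosedSet cA) : semiLocal cA cB ⊆ oneWay cA cB := by
  rintro h ⟨-, Z, m, hm, n, hn, rfl⟩
  refine mem_oneWay_iff.2 ⟨partialState m (discard Z),
    partialState_mem hA hm (mem_dual_firstOrder Z), fun τ hτ => ?_⟩
  apply partialState_compose
  have hd : stateToHom n ≫ τ ∈ dual (firstOrder Z) := by
    intro z hz
    rw [mem_parSet_iff] at hn
    rw [stateToHom_comp, ← comp_stateToEffect, partialState_comp,
      hn _ (stateToEffect_mem_dual hz) τ hτ]
  rw [← eq_discard_of_mem_dual hd, stateToHom_comp]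
  apply state_dual_ext
  intro z
  rw [effectToState_comp_stateToEffect, comp_stateToEffect]

/-- The state `f₁ ⊗ g₁ + f₂ ⊗ g₂`, where `f₁ + f₂` is normalised, is semi-localisable: it factorises
through a classical bit recording which summand occurred. -/
theorem tensorState_add_tensorState_mem_semiLocal {A B : C} {cA : Set (𝟙_ C ⟶ A)}
    {cB : Set (𝟙_ C ⟶ B)} {f₁ f₂ : 𝟙_ C ⟶ A} (hf : f₁ + f₂ ∈ cA) {g₁ g₂ : 𝟙_ C ⟶ B}
    (hg₁ : g₁ ∈ cB) (hg₂ : g₂ ∈ cB) :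
    tensorState f₁ g₁ + tensorState f₂ g₂ ∈ semiLocal cA cB := by
  obtain ⟨b, ⟨hb⟩, h1, h2⟩ := AdditivePrecausal.discard_biprod (𝟙_ C) (𝟙_ C)
  rw [AdditivePrecausal.discard_unit] at h1 h2
  have hsum : b.fst + b.snd = discard b.pt := by
    apply BinaryCofan.IsColimit.hom_ext hb.isColimit
    · change b.inl ≫ (b.fst + b.snd) = b.inl ≫ _
      rw [comp_add', discard, h1, b.inl_fst, b.inl_snd, add_zero]
    · change b.inr ≫ (b.fst + b.snd) = b.inr ≫ _
      rw [comp_add', discard, h2, b.inr_fst, b.inr_snd, zero_add]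
  refine ⟨?_, b.pt, tensorState f₁ b.inl + tensorState f₂ b.inr, ?_,
    tensorState (effectToState b.fst) g₁ + tensorState (effectToState b.snd) g₂, ?_, ?_⟩
  · rw [mem_parSet_iff]
    intro π hπ τ hτ
    rw [add_comp', tensorState_comp_tensorEffect, tensorState_comp_tensorEffect, hτ _ hg₁,
      hτ _ hg₂, Category.comp_id, Category.comp_id, ← add_comp', hπ _ hf]
  · rw [mem_parSet_iff]
    intro π hπ τ hτ
    rw [add_comp', tensorState_comp_tensorEffect, tensorState_comp_tensorEffect,
      eq_discard_of_mem_dual hτ, discard, h1, h2,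
      Category.comp_id, Category.comp_id, ← add_comp', hπ _ hf]
  · rw [mem_parSet_iff]
    intro π hπ τ hτ
    obtain ⟨z, hz, rfl⟩ := exists_stateToEffect_of_mem_dual (isClosedSet_firstOrder _) hπ
    rw [add_comp', tensorState_comp_tensorEffect, tensorState_comp_tensorEffect, hτ _ hg₁,
      hτ _ hg₂, Category.comp_id, Category.comp_id, effectToState_comp_stateToEffect,
      effectToState_comp_stateToEffect, ← comp_add', hsum, hz _ rfl]
  · have hadd : ∀ (x : 𝟙_ C ⟶ A ⊗ b.pt) (n n' : 𝟙_ C ⟶ dualObj b.pt ⊗ B),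
        compose x (n + n') = compose x n + compose x n' := by
      intro x n n'
      simp only [compose, tensorState_add_right, add_comp']
    rw [hadd, compose_eq, compose_eq, add_comp', add_comp']
    simp only [← compose_eq, compose_tensorState, b.inl_fst, b.inl_snd, b.inr_fst, b.inr_snd,
      Category.id_comp, zero_comp, add_zero, zero_add]

theorem tensorState_mem_semiLocal {A B : C} {cA : Set (𝟙_ C ⟶ A)} {cB : Set (𝟙_ C ⟶ B)}
    {f : 𝟙_ C ⟶ A} (hf : f ∈ cA) {g : 𝟙_ C ⟶ B} (hg : g ∈ cB) :
    tensorState f g ∈ semiLocal cA cB := by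
  have h := tensorState_add_tensorState_mem_semiLocal (f₁ := f) (f₂ := 0) (by rwa [add_zero]) hg hg
  rwa [← tensorState_add_left, add_zero] at h

/-- An effect normalised on semi-localisable states leaves the same effect on `A` for all `g`, `g'`
in `cB`: it takes the same value on `f ⊗ g + f' ⊗ g'` and on `(f + f') ⊗ g'` whenever `f + f'` is in
`cA`, and every state `f` of `A` has an invertible multiple that is such a summand. -/
theorem dual_semiLocal_subset {A B : C} {cA : Set (𝟙_ C ⟶ A)} {cB : Set (𝟙_ C ⟶ B)}
    (hA : IsFlat cA) : dual (semiLocal cA cB) ⊆ oneWayEffects cA cB := by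
  intro k hk
  have hmem : ∀ g ∈ cB, partialEffect k g ∈ dual cA := fun g hg f hf => by
    rw [comp_partialEffect, hk _ (tensorState_mem_semiLocal hf hg)]
  rcases cB.eq_empty_or_nonempty with rfl | ⟨g₀, hg₀⟩
  · rcases (dual cA).eq_empty_or_nonempty with hA0 | ⟨π, hπ⟩
    · -- The zero state factorises through the zero system, which has no causal state.
      exfalso
      have hne : 𝟙 (𝟙_ C) ≠ 0 := fun h0 => by
        have : (0 : A ⟶ 𝟙_ C) ∈ dual cA := fun ρ _ => by rw [comp_zero, h0]
        rwa [hA0] at this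
      refine hne ?_
      rw [← hk 0 ⟨?_, ⊤_ C, 0, ?_, 0, ?_, by rw [compose_eq, zero_comp]⟩, zero_comp]
      · rw [mem_parSet_iff, hA0]
        exact fun _ h => h.elim
      · rw [mem_parSet_iff, hA0]
        exact fun _ h => h.elim
      · rw [mem_parSet_iff]
        intro μ hμ
        obtain ⟨z, hz, -⟩ := exists_stateToEffect_of_mem_dual (isClosedSet_firstOrder _) hμ
        have := hz _ rfl
        rw [isZero_terminal.eq_of_tgt z 0, zero_comp] at this
        exact (hne this.symm).elim
    · exact ⟨π, hπ, fun _ h => h.elim⟩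
  refine ⟨partialEffect k g₀, hmem g₀ hg₀, fun g hg => ?_⟩
  rcases hA with ⟨l, m, hl, hm, hu, -⟩ | hz
  · apply hom_ext_states
    intro f
    obtain ⟨t, f', ht, e⟩ := exists_smul_add_eq_uniform f l
    rw [← e] at hu
    have e1 := hk _ (tensorState_add_tensorState_mem_semiLocal hu hg hg₀)
    have e2 := hk _ (tensorState_add_tensorState_mem_semiLocal hu hg₀ hg₀)
    rw [← e2, add_comp', add_comp'] at e1
    have e3 := add_right_cancel' _ _ _ e1
    simp only [tensorState_smul_left, Category.assoc, cancel_epi] at e3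
    simpa only [comp_partialEffect] using e3
  · exact hz.eq_of_src _ _

/-- A state normalised by `oneWayEffects` is one-way signalling: if `t • (φ ⊗ τ) + k` is the
multiple of discarding in `oneWayEffects`, then `t • (φ ⊗ τ') + k` is in `oneWayEffects` as well, for
all normalised `τ`, `τ'`, whence the partial states at `τ` and `τ'` agree on `φ`. -/
theorem dualEff_oneWayEffects_subset {A B : C} {cA : Set (𝟙_ C ⟶ A)} {cB : Set (𝟙_ C ⟶ B)}
    (hcA : IsClosedSet cA) (hA : IsFlat cA) (hB : IsFlat cB) :
    dualEff (oneWayEffects cA cB) ⊆ oneWay cA cB := by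
  intro h hh
  have hprod : ∀ π ∈ dual cA, ∀ τ ∈ dual cB, tensorEffect π τ ∈ oneWayEffects cA cB := by
    intro π hπ τ hτ
    refine ⟨π, hπ, fun σ hσ => ?_⟩
    have := partialEffect_tensorEffect_comp π τ (𝟙 _) σ
    rwa [hτ σ hσ, Category.comp_id, Category.comp_id, Category.comp_id] at this
  have hmem : ∀ τ ∈ dual cB, partialState h τ ∈ cA := fun τ hτ =>
    mem_of_normalised hcA fun π hπ => by rw [partialState_comp, hh _ (hprod π hπ τ hτ)]
  rw [mem_oneWay_iff]
  rcases (dual cB).eq_empty_or_nonempty with hB0 | ⟨τ₀, hτ₀⟩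
  · rw [hB0]
    rcases cA.eq_empty_or_nonempty with rfl | ⟨m, hm⟩
    · -- Here the zero effect is one-way signalling, so that the unit of `C` is a zero object.
      exfalso
      have h1 : h ≫ (0 : A ⊗ B ⟶ 𝟙_ C) = 𝟙 _ :=
        hh _ ⟨0, fun _ h => h.elim, fun σ _ => by simp only [partialEffect, comp_zero]⟩
      have : (0 : B ⟶ 𝟙_ C) ∈ dual cB := fun ρ _ => by rw [comp_zero, ← h1, comp_zero]
      rwa [hB0] at this
    · exact ⟨m, hm, fun _ h => h.elim⟩
  refine ⟨partialState h τ₀, hmem τ₀ hτ₀, fun τ hτ => ?_⟩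
  rcases hA with ⟨-, m, -, hm, -, hd⟩ | hz
  · rcases hB with ⟨-, m', -, hm', -, hd'⟩ | hz'
    · apply state_ext
      intro π
      rw [partialState_comp, partialState_comp]
      obtain ⟨t, k, ht, e⟩ := exists_smul_add_eq_discard (tensorEffect π τ) (m ≫ m')
      have ed : discard (A ⊗ B) ≫ m ≫ m' = tensorEffect (discard A ≫ m) (discard B ≫ m') := by
        apply tensor_hom_ext
        intro ρ σ
        have em : σ ≫ discard B ≫ m ≫ m' = m ≫ σ ≫ discard B ≫ m' := by
          simpa using congrArg (· ≫ m') (scalar_comm (σ ≫ discard B) m)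
        rw [discard, AdditivePrecausal.discard_tensor, ← Category.assoc,
          tensorState_comp_tensorEffect, tensorState_comp_tensorEffect]
        simp only [Category.assoc]
        exact congrArg (ρ ≫ discard A ≫ ·) em
      have e1 := hh _ (hprod _ hd _ hd')
      rw [← ed, ← e, comp_add'] at e1
      -- Exchanging `τ` for `τ₀` does not change the partial effects at states in `cB`.
      have e2 : h ≫ (tensorEffect π τ₀ ≫ t + k) = 𝟙 _ := by
        refine hh _ ⟨discard A ≫ m, hd, fun σ hσ => ?_⟩
        have e3 : partialEffect (tensorEffect π τ₀ ≫ t) σ =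
            partialEffect (tensorEffect π τ ≫ t) σ := by
          rw [partialEffect_tensorEffect_comp, partialEffect_tensorEffect_comp, hτ σ hσ, hτ₀ σ hσ]
        rw [partialEffect_add, e3, ← partialEffect_add, e, ed]
        have := partialEffect_tensorEffect_comp (discard A ≫ m) (discard B ≫ m') (𝟙 _) σ
        rwa [hd' σ hσ, Category.comp_id, Category.comp_id, Category.comp_id] at this
      rw [← e2, comp_add'] at e1
      have e4 := add_right_cancel' _ _ _ e1
      rw [← cancel_mono t, Category.assoc, Category.assoc]
      exact e4
    · rw [hz'.eq_of_src τ τ₀]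
  · exact hz.eq_of_tgt _ _

end OneWaySignalling

/-! ### Functionals on a finite-dimensional space -/

section LinearAlgebra

/-- A linear map on a finite-dimensional space that vanishes on the common kernel of a family
of functionals is a combination of finitely many of them, with vectors as coefficients. -/
theorem exists_eq_sum_of_common_ker {F E V : Type*} [Field F] [AddCommGroup E] [AddCommGroup V]
    [Module F E] [Module F V] [FiniteDimensional F E] {ι : Type*} (s : ι → E →ₗ[F] F)
    (H : E →ₗ[F] V) (hH : ∀ e, (∀ i, s i e = 0) → H e = 0) :
    ∃ (n : ℕ) (v : Fin n → V) (j : Fin n → ι), ∀ e, H e = ∑ i, s (j i) e • v i := by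
  obtain ⟨f, hf, hspan, -⟩ := Submodule.exists_fun_fin_finrank_span_eq F (Set.range s)
  choose j hj using hf
  let φ := LinearMap.pi f
  have hle : LinearMap.ker φ ≤ LinearMap.ker H := by
    intro e he
    refine hH e fun i => ?_
    have hs : s i ∈ Submodule.span F (Set.range f) := by
      rw [hspan]
      exact Submodule.subset_span ⟨i, rfl⟩
    generalize s i = x at hs
    induction hs using Submodule.span_induction with
    | mem x hx =>
      obtain ⟨k, rfl⟩ := hx
      exact congrFun he k
    | zero => rfl
    | add x y _ _ hx hy => rw [LinearMap.add_apply, hx, hy, add_zero]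
    | smul a x _ hx => rw [LinearMap.smul_apply, hx, smul_zero]
  obtain ⟨L, hL⟩ := ((LinearMap.ker φ).liftQ H hle ∘ₗ
    φ.quotKerEquivRange.symm.toLinearMap).exists_extend
  refine ⟨_, fun i => L (Pi.single i 1), j, fun e => ?_⟩
  have h1 : L (φ e) = H e := by
    have := LinearMap.congr_fun hL ⟨φ e, LinearMap.mem_range_self φ e⟩
    simpa using this
  rw [← h1]
  conv_lhs => rw [← Finset.univ_sum_single (φ e), map_sum]
  refine Finset.sum_congr rfl fun i _ => ?_
  rw [← map_smul, ← Pi.single_smul', smul_eq_mul, mul_one, hj]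
  rfl

end LinearAlgebra

/-! ### The subtractive closure and its field of scalars -/

section SubtractiveClosure

variable {C : Type u} [Category.{v} C] [MonoidalCategory C] [SymmetricCategory C]
  [LeftRigidCategory C] [HasFiniteProducts C] [AdditivePrecausal C]

theorem toSub_injective {X Y : C} : Function.Injective (toSub : (X ⟶ Y) →+ SubHom X Y) := by
  intro f g h
  have := (toSub_sub_eq_iff f 0 g 0).1 (by rw [h])
  rwa [add_zero, add_zero] at this

theorem exists_toSub_sub {X Y : C} (x : SubHom X Y) : ∃ f g : X ⟶ Y, x = toSub f - toSub g := by
  induction x using AddLocalization.ind with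
  | _ p =>
    refine ⟨p.1, p.2, ?_⟩
    change _ = AddLocalization.mk p.1 0 - AddLocalization.mk p.2.1 0
    rw [Algebra.GrothendieckAddGroup.mk_sub_mk]
    congr 1
    · exact (add_zero _).symm
    · exact Subtype.ext (zero_add _).symm

theorem lift_toSub {M G : Type v} [AddCommMonoid M] [AddCommGroup G] (φ : M →+ G) (x : M) :
    Algebra.GrothendieckAddGroup.lift φ (Algebra.GrothendieckAddGroup.of x) = φ x :=
  DFunLike.congr_fun (Algebra.GrothendieckAddGroup.lift.left_inv φ) x

/-- Composition as a biadditive map. -/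
def compHom' (X Y Z : C) : (X ⟶ Y) →+ (Y ⟶ Z) →+ (X ⟶ Z) where
  toFun f :=
    { toFun := fun g => f ≫ g
      map_zero' := comp_zero
      map_add' := comp_add' f }
  map_zero' := by
    ext g
    exact zero_comp
  map_add' f f' := by
    ext g
    exact add_comp' f f' g

/-- Composition in the subtractive closure. -/
def subComp {X Y Z : C} : SubHom X Y →+ SubHom Y Z →+ SubHom X Z :=
  AddMonoidHom.flip (Algebra.GrothendieckAddGroup.lift (AddMonoidHom.flip
    (Algebra.GrothendieckAddGroup.lift ((AddMonoidHom.compHom toSub).comp (compHom' X Y Z)))))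

theorem subComp_toSub {X Y Z : C} (f : X ⟶ Y) (g : Y ⟶ Z) :
    subComp (toSub f) (toSub g) = toSub (f ≫ g) := by
  rw [subComp, AddMonoidHom.flip_apply, lift_toSub, AddMonoidHom.flip_apply, lift_toSub]
  rfl

theorem subComp_assoc {W X Y Z : C} (f : SubHom W X) (g : SubHom X Y) (h : SubHom Y Z) :
    subComp (subComp f g) h = subComp f (subComp g h) := by
  obtain ⟨f, f', rfl⟩ := exists_toSub_sub f
  obtain ⟨g, g', rfl⟩ := exists_toSub_sub g
  obtain ⟨h, h', rfl⟩ := exists_toSub_sub h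
  simp only [map_sub, AddMonoidHom.sub_apply, subComp_toSub, Category.assoc]

theorem subComp_id {X Y : C} (f : SubHom X Y) : subComp f (toSub (𝟙 Y)) = f := by
  obtain ⟨f, f', rfl⟩ := exists_toSub_sub f
  simp only [map_sub, AddMonoidHom.sub_apply, subComp_toSub, Category.comp_id]

theorem id_subComp {X Y : C} (f : SubHom X Y) : subComp (toSub (𝟙 X)) f = f := by
  obtain ⟨f, f', rfl⟩ := exists_toSub_sub f
  simp only [map_sub, subComp_toSub, Category.id_comp]

theorem subComp_comm (x y : SubHom (𝟙_ C) (𝟙_ C)) : subComp x y = subComp y x := by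
  obtain ⟨x, x', rfl⟩ := exists_toSub_sub x
  obtain ⟨y, y', rfl⟩ := exists_toSub_sub y
  simp only [map_sub, AddMonoidHom.sub_apply, subComp_toSub, scalar_comm y, scalar_comm y']
  abel

/-- Scalars are totally preordered, so that every formal difference of scalars is a scalar or the
negative of a scalar. -/
theorem exists_subComp_eq_id {x : SubHom (𝟙_ C) (𝟙_ C)} (hx : x ≠ 0) :
    ∃ y : SubHom (𝟙_ C) (𝟙_ C), subComp x y = toSub (𝟙 _) := by
  have key : ∀ z : 𝟙_ C ⟶ 𝟙_ C, toSub z ≠ 0 → ∃ y : SubHom (𝟙_ C) (𝟙_ C),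
      subComp (toSub z) y = toSub (𝟙 _) := by
    intro z hz
    have := AdditivePrecausal.scalar_isIso z (by rintro rfl; exact hz (map_zero _))
    exact ⟨toSub (inv z), by rw [subComp_toSub, IsIso.hom_inv_id]⟩
  obtain ⟨f, g, rfl⟩ := exists_toSub_sub x
  obtain ⟨z, rfl | rfl⟩ := AdditivePrecausal.scalar_total f g
  · rw [map_add, sub_add_cancel_left] at hx ⊢
    obtain ⟨y, hy⟩ := key z (neg_ne_zero.1 hx)
    exact ⟨-y, by rw [map_neg, map_neg, AddMonoidHom.neg_apply, neg_neg, hy]⟩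
  · rw [map_add, add_sub_cancel_left] at hx ⊢
    exact key z hx

/-- The scalars of the subtractive closure form a field under composition, if `𝟙_ C` is not a zero
object. -/
@[reducible]
def subField (h : 𝟙 (𝟙_ C) ≠ 0) : Field (SubHom (𝟙_ C) (𝟙_ C)) :=
  letI R : CommRing (SubHom (𝟙_ C) (𝟙_ C)) :=
    { (inferInstance : AddCommGroup (SubHom (𝟙_ C) (𝟙_ C))) with
      mul := fun x y => subComp x y
      one := toSub (𝟙 _)
      mul_assoc := subComp_assoc
      one_mul := id_subComp
      mul_one := subComp_id
      mul_comm := subComp_comm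
      zero_mul := fun x => by
        change subComp 0 x = 0
        rw [map_zero, AddMonoidHom.zero_apply]
      mul_zero := fun x => map_zero (subComp x)
      left_distrib := fun x => map_add (subComp x)
      right_distrib := fun x y z => by
        change subComp (x + y) z = subComp x z + subComp y z
        rw [map_add, AddMonoidHom.add_apply] }
  (show IsField (SubHom (𝟙_ C) (𝟙_ C)) from
    { exists_pair_ne := ⟨toSub (𝟙 _), 0, fun e => h (toSub_injective (e.trans (map_zero _).symm))⟩
      mul_comm := subComp_comm
      mul_inv_cancel := exists_subComp_eq_id }).toField

end SubtractiveClosure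

/-! ### One-way signalling states as finite sums -/

section FiniteSums

variable {C : Type u} [Category.{v} C] [MonoidalCategory C] [SymmetricCategory C]
  [LeftRigidCategory C] [HasFiniteProducts C] [AdditivePrecausal C]

/-- Effects of the subtractive closure form a vector space over its scalars. -/
@[reducible]
def effectModule (h : 𝟙 (𝟙_ C) ≠ 0) (B : C) :
    letI := subField h
    Module (SubHom (𝟙_ C) (𝟙_ C)) (SubHom B (𝟙_ C)) :=
  letI := subField h
  { smul := fun r e => subComp e r
    one_smul := subComp_id
    mul_smul := fun r s e => by
      change subComp e (subComp r s) = subComp (subComp e s) r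
      rw [subComp_comm r, subComp_assoc]
    smul_zero := fun r => by
      change subComp 0 r = 0
      rw [map_zero, AddMonoidHom.zero_apply]
    smul_add := fun r e e' => by
      change subComp (e + e') r = subComp e r + subComp e' r
      rw [map_add, AddMonoidHom.add_apply]
    add_smul := fun r s e => map_add (subComp e) r s
    zero_smul := fun e => map_zero (subComp e) }

/-- States of the subtractive closure form a vector space over its scalars. -/
@[reducible]
def stateModule (h : 𝟙 (𝟙_ C) ≠ 0) (A : C) :
    letI := subField h
    Module (SubHom (𝟙_ C) (𝟙_ C)) (SubHom (𝟙_ C) A) :=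
  letI := subField h
  { smul := fun r v => subComp r v
    one_smul := id_subComp
    mul_smul := fun r s v => subComp_assoc r s v
    smul_zero := fun r => map_zero (subComp r)
    smul_add := fun r => map_add (subComp r)
    add_smul := fun r s v => by
      change subComp (r + s) v = subComp r v + subComp s v
      rw [map_add, AddMonoidHom.add_apply]
    zero_smul := fun v => by
      change subComp 0 v = 0
      rw [map_zero, AddMonoidHom.zero_apply] }

/-- A finite basis of states of `B` embeds the effects on `B` into a finite power of the scalars. -/
theorem effect_finiteDimensional (h : 𝟙 (𝟙_ C) ≠ 0) (B : C) :
    letI := subField h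
    letI := effectModule h B
    FiniteDimensional (SubHom (𝟙_ C) (𝟙_ C)) (SubHom B (𝟙_ C)) := by
  let := subField h
  let := effectModule h B
  obtain ⟨n, ρ, -, hρ⟩ := AdditivePrecausal.exists_basis B
  let φ : SubHom B (𝟙_ C) →ₗ[SubHom (𝟙_ C) (𝟙_ C)] (Fin n → SubHom (𝟙_ C) (𝟙_ C)) :=
    { toFun := fun e i => subComp (toSub (ρ i)) e
      map_add' := fun e e' => funext fun i => map_add (subComp (toSub (ρ i))) e e'
      map_smul' := fun r e => funext fun i => by
        change subComp (toSub (ρ i)) (subComp e r) = subComp r (subComp (toSub (ρ i)) e)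
        rw [subComp_comm r, subComp_assoc] }
  refine FiniteDimensional.of_injective φ fun x y hxy => ?_
  obtain ⟨e, e', rfl⟩ := exists_toSub_sub x
  obtain ⟨f, f', rfl⟩ := exists_toSub_sub y
  rw [toSub_sub_eq_iff]
  apply hρ
  intro i
  have hi : subComp (toSub (ρ i)) (toSub e - toSub e') =
    subComp (toSub (ρ i)) (toSub f - toSub f') := congrFun hxy i
  simp only [map_sub, subComp_toSub] at hi
  rw [comp_add', comp_add', ← toSub_sub_eq_iff]
  exact hi

/-- If the partial states of `h` depend only on the values of an effect on the states in `c`, then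
they are combinations of finitely many of these values. -/
theorem exists_partialState_eq_sum (h1 : 𝟙 (𝟙_ C) ≠ 0) {A B : C} (c : Set (𝟙_ C ⟶ B))
    (h : 𝟙_ C ⟶ A ⊗ B)
    (hh : ∀ τ τ' : B ⟶ 𝟙_ C, (∀ σ ∈ c, σ ≫ τ = σ ≫ τ') → partialState h τ = partialState h τ') :
    ∃ (n : ℕ) (f : Fin n → SubHom (𝟙_ C) A) (g : Fin n → (𝟙_ C ⟶ B)), (∀ i, g i ∈ c) ∧
      ∀ τ : B ⟶ 𝟙_ C, toSub (partialState h τ) = ∑ i, subComp (toSub (g i ≫ τ)) (f i) := by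
  let := subField h1
  let := effectModule h1 B
  let := stateModule h1 A
  have := effect_finiteDimensional h1 B
  let s : c → SubHom B (𝟙_ C) →ₗ[SubHom (𝟙_ C) (𝟙_ C)] SubHom (𝟙_ C) (𝟙_ C) := fun g =>
    { toFun := fun e => subComp (toSub g.1) e
      map_add' := map_add (subComp (toSub g.1))
      map_smul' := fun r e => by
        change subComp (toSub g.1) (subComp e r) = subComp r (subComp (toSub g.1) e)
        rw [subComp_comm r, subComp_assoc] }
  let p : (B ⟶ 𝟙_ C) →+ SubHom (𝟙_ C) A :=
    { toFun := fun τ => toSub (partialState h τ)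
      map_zero' := by rw [partialState_zero, map_zero]
      map_add' := fun τ τ' => by rw [partialState_add, map_add] }
  have hp : ∀ τ, Algebra.GrothendieckAddGroup.lift p (toSub τ) = toSub (partialState h τ) :=
    lift_toSub p
  let H : SubHom B (𝟙_ C) →ₗ[SubHom (𝟙_ C) (𝟙_ C)] SubHom (𝟙_ C) A :=
    { toFun := Algebra.GrothendieckAddGroup.lift p
      map_add' := map_add _
      map_smul' := fun r e => by
        change Algebra.GrothendieckAddGroup.lift p (subComp e r) =
          subComp r (Algebra.GrothendieckAddGroup.lift p e)
        obtain ⟨r, r', rfl⟩ := exists_toSub_sub r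
        obtain ⟨e, e', rfl⟩ := exists_toSub_sub e
        simp only [map_sub, AddMonoidHom.sub_apply, subComp_toSub, hp, partialState_smul]
        abel }
  obtain ⟨n, f, j, e⟩ := exists_eq_sum_of_common_ker s H (by
    intro x hx
    obtain ⟨τ, τ', rfl⟩ := exists_toSub_sub x
    change Algebra.GrothendieckAddGroup.lift p _ = 0
    rw [map_sub, hp, hp, sub_eq_zero]
    congr 1
    refine hh τ τ' fun σ hσ => toSub_injective ?_
    have h0 : subComp (toSub σ) (toSub τ - toSub τ') = 0 := hx ⟨σ, hσ⟩
    rwa [map_sub, subComp_toSub, subComp_toSub, sub_eq_zero] at h0)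
  refine ⟨n, f, fun i => (j i).1, fun i => (j i).2, fun τ => ?_⟩
  rw [← hp]
  simp only [← subComp_toSub]
  exact e (toSub τ)

/-- The partial states of a one-way signalling state only depend on the values of an effect on
`cB`, because two effects that agree on `cB` have multiples that become normalised by
adding the same effect. -/
theorem partialState_eq_of_mem_oneWay {A B : C} {cA : Set (𝟙_ C ⟶ A)} {cB : Set (𝟙_ C ⟶ B)}
    (hB : IsFlat cB) {h : 𝟙_ C ⟶ A ⊗ B} (hh : h ∈ oneWay cA cB) {τ τ' : B ⟶ 𝟙_ C}
    (e : ∀ σ ∈ cB, σ ≫ τ = σ ≫ τ') : partialState h τ = partialState h τ' := by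
  rcases hB with ⟨-, m, -, hm, -, hd⟩ | hz
  · obtain ⟨n, -, hn⟩ := mem_oneWay_iff.1 hh
    -- The effects `t • τ + k` and `t • τ' + k` are both normalised.
    obtain ⟨t, k, ht, ek⟩ := exists_smul_add_eq_discard τ m
    have hk : τ' ≫ t + k ∈ dual cB := fun σ hσ => by
      rw [comp_add', ← Category.assoc, ← e σ hσ, Category.assoc, ← comp_add', ek, hd σ hσ]
    have e1 := (hn _ hd).trans (hn _ hk).symm
    rw [← ek, partialState_add, partialState_add] at e1
    have e2 := add_right_cancel' _ _ _ e1
    rwa [partialState_smul, partialState_smul, cancel_epi] at e2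
  · rw [hz.eq_of_src τ τ']

theorem subTensor_comp_tensorEffect {A B : C} (f : SubHom (𝟙_ C) A) (g : 𝟙_ C ⟶ B)
    (π : A ⟶ 𝟙_ C) (τ : B ⟶ 𝟙_ C) :
    subComp (subTensor A B f (toSub g)) (toSub (tensorEffect π τ)) =
      subComp (subComp (toSub (g ≫ τ)) f) (toSub π) := by
  obtain ⟨f, f', rfl⟩ := exists_toSub_sub f
  simp only [map_sub, AddMonoidHom.sub_apply, subTensor_toSub, subComp_toSub,
    tensorState_comp_tensorEffect, Category.assoc]
  have e : ∀ f : 𝟙_ C ⟶ A, f ≫ π ≫ g ≫ τ = g ≫ τ ≫ f ≫ π := fun f => by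
    simpa using scalar_comm (f ≫ π) (g ≫ τ)
  rw [e, e]

theorem sub_tensor_state_ext {A B : C} {x y : SubHom (𝟙_ C) (A ⊗ B)}
    (e : ∀ (π : A ⟶ 𝟙_ C) (τ : B ⟶ 𝟙_ C),
      subComp x (toSub (tensorEffect π τ)) = subComp y (toSub (tensorEffect π τ))) : x = y := by
  obtain ⟨h, h', rfl⟩ := exists_toSub_sub x
  obtain ⟨k, k', rfl⟩ := exists_toSub_sub y
  rw [toSub_sub_eq_iff]
  apply tensor_state_ext
  intro π τ
  rw [add_comp', add_comp', ← toSub_sub_eq_iff]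
  simpa only [map_sub, AddMonoidHom.sub_apply, subComp_toSub] using e π τ

/-- The states `gᵢ` come from finitely many functionals spanning those given by `cB`, and any
normalised effect on `B` shows that the coefficients `fᵢ` sum to the common partial state. -/
theorem oneWay_subset_coherenceSeq {A B : C} {cA : Set (𝟙_ C ⟶ A)} {cB : Set (𝟙_ C ⟶ B)}
    (hB : IsFlat cB) : oneWay cA cB ⊆ coherenceSeq cA cB := by
  intro h hh
  refine ⟨hh.1, ?_⟩
  obtain ⟨m, hm, hmτ⟩ := mem_oneWay_iff.1 hh
  by_cases h1 : 𝟙 (𝟙_ C) = 0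
  · -- All states are zero, and the empty sum will do.
    have hz : ∀ {X : C} (x : 𝟙_ C ⟶ X), x = 0 := fun x => by
      rw [← Category.id_comp x, h1, zero_comp]
    exact ⟨0, fun _ => 0, fun _ => 0, fun i => i.elim0, m, hm, by simp [hz h], by simp [hz m]⟩
  obtain ⟨n, f, g, hg, e⟩ := exists_partialState_eq_sum h1 cB h
    fun τ τ' => partialState_eq_of_mem_oneWay hB hh
  have eh : toSub h = ∑ i, subTensor A B (f i) (toSub (g i)) := by
    apply sub_tensor_state_ext
    intro π τ
    rw [subComp_toSub, ← partialState_comp, ← subComp_toSub, e, map_sum, map_sum,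
      AddMonoidHom.finsetSum_apply, AddMonoidHom.finsetSum_apply]
    simp only [subTensor_comp_tensorEffect]
  rcases (dual cB).eq_empty_or_nonempty with hB0 | ⟨τ, hτ⟩
  · -- Here `B` is a zero object, and `h` is the product of `m` with any state of `B`.
    obtain ⟨g₀, hg₀⟩ : cB.Nonempty := by
      rw [Set.nonempty_iff_ne_empty]
      rintro rfl
      have : (0 : B ⟶ 𝟙_ C) ∈ dual (∅ : Set (𝟙_ C ⟶ B)) := fun _ h => h.elim
      rwa [hB0] at this
    have hz : IsZero B := hB.resolve_left fun ⟨_, _, _, _, _, hd⟩ => by rwa [hB0] at hd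
    have eg : h = tensorState m g₀ := by
      apply tensor_state_ext
      intro π τ
      rw [← partialState_comp, ← partialState_comp, hz.eq_of_src τ 0, partialState_zero,
        partialState_zero]
    exact ⟨1, fun _ => toSub m, fun _ => g₀, fun _ => hg₀, m, hm, by
      rw [Fin.sum_univ_one, subTensor_toSub, eg], by rw [Fin.sum_univ_one]⟩
  · refine ⟨n, f, g, hg, m, hm, eh, ?_⟩
    rw [← hmτ τ hτ, e]
    refine Finset.sum_congr rfl fun i _ => ?_
    rw [hτ _ (hg i), id_subComp]

/-- A normalised effect on `B` sends every `gᵢ` to `1`, so that it leaves the state `∑ fᵢ`. -/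
theorem coherenceSeq_subset_oneWay {A B : C} {cA : Set (𝟙_ C ⟶ A)} {cB : Set (𝟙_ C ⟶ B)} :
    coherenceSeq cA cB ⊆ oneWay cA cB := by
  rintro h ⟨-, n, f, g, hg, m, hm, eh, em⟩
  refine mem_oneWay_iff.2 ⟨m, hm, fun τ hτ => state_ext fun π => toSub_injective ?_⟩
  rw [partialState_comp, ← subComp_toSub, ← subComp_toSub, eh, em, map_sum, map_sum,
      AddMonoidHom.finsetSum_apply, AddMonoidHom.finsetSum_apply]
  refine Finset.sum_congr rfl fun i _ => ?_
  rw [subTensor_comp_tensorEffect, hτ _ (hg i), id_subComp]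

/-- Writing a one-way signalling state as `∑ fᵢ ⊗ gᵢ`, an effect `k` that leaves the same `π` for
every `gᵢ` takes the value of `π` on `∑ fᵢ`. -/
theorem oneWay_subset_dualEff_oneWayEffects {A B : C} {cA : Set (𝟙_ C ⟶ A)} {cB : Set (𝟙_ C ⟶ B)}
    (hB : IsFlat cB) : oneWay cA cB ⊆ dualEff (oneWayEffects cA cB) := by
  rintro h hh k ⟨π, hπ, e⟩
  obtain ⟨-, n, f, g, hg, m, hm, eh, em⟩ := oneWay_subset_coherenceSeq hB hh
  have key : ∀ (f : SubHom (𝟙_ C) A) (g : 𝟙_ C ⟶ B),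
      subComp (subTensor A B f (toSub g)) (toSub k) = subComp f (toSub (partialEffect k g)) := by
    intro f g
    obtain ⟨f, f', rfl⟩ := exists_toSub_sub f
    simp only [map_sub, AddMonoidHom.sub_apply, subTensor_toSub, subComp_toSub,
      comp_partialEffect]
  rw [← hπ m hm]
  apply toSub_injective
  rw [← subComp_toSub, ← subComp_toSub, eh, em, map_sum, map_sum,
    AddMonoidHom.finsetSum_apply, AddMonoidHom.finsetSum_apply]
  refine Finset.sum_congr rfl fun i _ => ?_
  rw [key, e _ (hg i)]

theorem oneWay_eq_dualEff_oneWayEffects {A B : C} {cA : Set (𝟙_ C ⟶ A)} {cB : Set (𝟙_ C ⟶ B)}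
    (hcA : IsClosedSet cA) (hA : IsFlat cA) (hB : IsFlat cB) :
    oneWay cA cB = dualEff (oneWayEffects cA cB) :=
  (oneWay_subset_dualEff_oneWayEffects hB).antisymm (dualEff_oneWayEffects_subset hcA hA hB)

end FiniteSums

end HigherOrder

end

open HigherOrder
theorem mainTheorem2 {C : Type u} [Category.{v} C] [MonoidalCategory C] [SymmetricCategory C]
    [LeftRigidCategory C] [HasFiniteProducts C] [AdditivePrecausal C] (A B : Caus C) :
    oneWay A.states B.states =
        dualStates₂ (oneWay (dualStates A.states) (dualStates B.states)) ∧
      oneWay A.states B.states = dualEff (dual (semiLocal A.states B.states)) ∧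
      oneWay A.states B.states = coherenceSeq A.states B.states := by
  have h := oneWay_eq_dualEff_oneWayEffects A.closed A.flat B.flat
  refine ⟨?_, ?_, ?_⟩
  · rw [dualStates₂, image_oneWay_dualStates B.closed, h]
  · apply Set.Subset.antisymm
    · rw [h]
      exact fun x hx k hk => hx k (dual_semiLocal_subset A.flat hk)
    · intro x hx
      rw [h]
      exact fun k hk => hx k fun y hy => by
        have := semiLocal_subset_oneWay A.closed hy
        rw [h] at this
        exact this k hk
  · exact (oneWay_subset_coherenceSeq B.flat).antisymm coherenceSeq_subset_oneWay
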